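/- Let $n\ge 1$ be an integer, let $k_0=a+ib\in\mathbb C$ with $b>0$, and let $\gamma$ be a complex function that is analytic at $k_0$. For $k\in\mathbb C$ and $(x,y,t)\in\mathbb R^3$ put $\theta(k)=kx+k^2y+k^3t+\gamma(k)$. For $m\ge 0$ let $$\phi_m=\frac1{m!}\,\partial_k^m e^{i\theta(k)}\Big|_{k=k_0}=p_m\,e^{i\theta(k_0)},$$ which defines the generalized Schur polynomials $p_m=p_m(x,y,t)$, and let $$\tau_n=\int_x^\infty|\phi_n|^2\,dx',\qquad u_n=2\,\partial_x^2\ln\tau_n,\qquad F_n=\sum_{j=0}^{2n}\frac{\partial_x^j|p_n|^2}{(2b)^j}.$$ The function $u_n$ is the $n$-lump potential. Its reduced eigenfunction is the rational function of $k$ $$\mu(x,y,t,k)=1+\frac{k_0-\bar k_0}{k-k_0}\left[\frac{F_n-p_n\bar p_n}{F_n}-\frac{p_n}{F_n}\sum_{j=1}^n\frac{\bar p_{n-j}}{(k-\bar k_0)^j}\right].$$ Let $\mu_{\bar j}$ $(1\le j\le n)$ denote the coefficient of $(k-\bar k_0)^{-j}$ in the Laurent expansion (equivalently, the partial fraction decomposition)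 of $\mu$ at $k=\bar k_0$. For every fixed $t\in\mathbb R$ the following hold. (i) For all $(x,y)\in\mathbb R^2$ and all $k\neq k_0$ with $\operatorname{Im}k>-b$, the function $\mu(k)e^{i\theta(k)}$ equals the binary Darboux transform $$\psi_n=\psi_0-\frac{\int_x^\infty\psi_0\bar\phi_n\,dx'}{\int_x^\infty\phi_n\bar\phi_n\,dx'}\,\phi_n,\qquad \psi_0=\frac{k-\bar k_0}{k-k_0}\,e^{i\theta(k)} .$$ (ii) For $k_\alpha=k_0$ and for $k_\alpha=\bar k_0$, the function $u_n\,\mathrm{Res}_{k_\alpha}\mu$ is Lebesgue integrable over $\mathbb R^2$ (in the variables $x,y$), and the topological charge is $$Q(k_\alpha)=\frac{\operatorname{sgn}(\operatorname{Im}k_\alpha)}{2\pi i}\iint_{\mathbb R^2}u_n\,\mathrm{Res}_{k_\alpha}\mu\,dx\,dy=n .$$ (iii) For $2\le j\le n$ the function $u_n\,\mu_{\bar j}$ is Lebesgue integrable over $\mathbb R^2$, and $\iint_{\mathbb R^2}u_n\,\mu_{\bar j}\,dx\,dy=0$. -/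

import Mathlib

namespace KPLump

open Complex MeasureTheory Filter Topology

noncomputable section

/-- The phase `θ(k) = k x + k² y + k³ t + γ(k)`. -/
def theta (γ : ℂ → ℂ) (k : ℂ) (x y t : ℝ) : ℂ :=
  k * x + k ^ 2 * y + k ^ 3 * t + γ k

/-- The function `φ_n = (1/n!) ∂_k^n exp(iθ)`, evaluated at the parameter `k`. -/
def phi (γ : ℂ → ℂ) (n : ℕ) (k : ℂ) (x y t : ℝ) : ℂ :=
  (1 / (n.factorial : ℂ)) * iteratedDeriv n (fun κ : ℂ => exp (I * theta γ κ x y t)) k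

/-- The generalized Schur polynomial `p_n`, determined by `φ_n = p_n exp(iθ)`. -/
def schurP (γ : ℂ → ℂ) (n : ℕ) (k : ℂ) (x y t : ℝ) : ℂ :=
  phi γ n k x y t * exp (-(I * theta γ k x y t))

/-- The `n`-lump tau function `τ_n = ∫_x^∞ |φ_n|² dx'` at the parameter `k₀`. -/
def tau (γ : ℂ → ℂ) (n : ℕ) (k₀ : ℂ) (x y t : ℝ) : ℝ :=
  ∫ x' in Set.Ioi x, ‖phi γ n k₀ x' y t‖ ^ 2

/-- The `n`-lump potential `u_n = 2 ∂_x² log τ_n`. -/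
def lumpU (γ : ℂ → ℂ) (n : ℕ) (k₀ : ℂ) (x y t : ℝ) : ℝ :=
  2 * iteratedDeriv 2 (fun x' : ℝ => Real.log (tau γ n k₀ x' y t)) x

/-- The polynomial `F_n = ∑_{j=0}^{2n} (2b)^{-j} ∂_x^j |p_n|²`, where `b = Im k₀`. -/
def lumpF (γ : ℂ → ℂ) (n : ℕ) (k₀ : ℂ) (x y t : ℝ) : ℝ :=
  ∑ j ∈ Finset.range (2 * n + 1),
    iteratedDeriv j (fun x' : ℝ => ‖schurP γ n k₀ x' y t‖ ^ 2) x / (2 * k₀.im) ^ j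

/-- The reduced eigenfunction `μ(k)` of the `n`-lump potential, a rational function of `k` with
poles at `k₀` and `conj k₀` only. -/
def mu (γ : ℂ → ℂ) (n : ℕ) (k₀ : ℂ) (x y t : ℝ) (k : ℂ) : ℂ :=
  let F : ℂ := lumpF γ n k₀ x y t
  let p : ℕ → ℂ := fun m => schurP γ m k₀ x y t
  1 + (k₀ - star k₀) / (k - k₀) *
    ((F - p n * star (p n)) / F -
      p n / F * ∑ j ∈ Finset.Icc 1 n, star (p (n - j)) / (k - star k₀) ^ j)

/-- `M(f, g)(x) = ∫_x^∞ f g dx'`. -/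
def bilinM (f g : ℝ → ℂ) (x : ℝ) : ℂ :=
  ∫ x' in Set.Ioi x, f x' * g x'

/-- The seed `ψ₀ = A(k) exp(iθ(k))` with `A(k) = (k - conj k₀) / (k - k₀)`. -/
def seed (γ : ℂ → ℂ) (k₀ : ℂ) (k : ℂ) (x y t : ℝ) : ℂ :=
  (k - star k₀) / (k - k₀) * exp (I * theta γ k x y t)

/-- The binary Darboux transform `ψ_n = ψ₀ - (M(ψ₀, conj φ_n) / M(φ_n, conj φ_n)) φ_n` of the
seed `ψ₀`; the integral `M(ψ₀, conj φ_n)` converges for `Im k > - Im k₀`. -/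
def darbouxPsi (γ : ℂ → ℂ) (n : ℕ) (k₀ : ℂ) (x y t : ℝ) (k : ℂ) : ℂ :=
  seed γ k₀ k x y t -
    bilinM (fun x' => seed γ k₀ k x' y t) (fun x' => star (phi γ n k₀ x' y t)) x /
      bilinM (fun x' => phi γ n k₀ x' y t) (fun x' => star (phi γ n k₀ x' y t)) x *
    phi γ n k₀ x y t

/-- The coefficient of `(z - c)^m` in the Laurent expansion of `f` about the isolated singularity
`c`, as the Cauchy integral over a small circle about `c`: the integral does not depend on the
radius `r` once `f` is holomorphic in the punctured disc of radius `r`. -/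
def laurentCoeff (f : ℂ → ℂ) (c : ℂ) (m : ℤ) : ℂ :=
  limUnder (𝓝[>] (0 : ℝ)) fun r : ℝ =>
    (2 * (Real.pi : ℂ) * I)⁻¹ * ∮ z in C(c, r), (z - c) ^ (-m - 1) * f z

/-- The residue of `f` at `c`. -/
def residue (f : ℂ → ℂ) (c : ℂ) : ℂ := laurentCoeff f c (-1)

/-- The coefficient `μ_{\bar j}` of `(k - conj k₀)^{-j}` in the partial fraction decomposition
of `μ`; it is the Laurent coefficient of `μ` at `conj k₀`. -/
def muBar (γ : ℂ → ℂ) (n : ℕ) (k₀ : ℂ) (j : ℕ) (x y t : ℝ) : ℂ :=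
  laurentCoeff (mu γ n k₀ x y t) (star k₀) (-(j : ℤ))

/-- The topological charge
`Q(k_α) = (sgn(Im k_α) / (2πi)) ∬_{ℝ²} u_n Res_{k_α} μ(k) dx dy` at time `t`. -/
def charge (γ : ℂ → ℂ) (n : ℕ) (k₀ kα : ℂ) (t : ℝ) : ℂ :=
  (Real.sign kα.im : ℂ) / (2 * (Real.pi : ℂ) * I) *
    ∫ q : ℝ × ℝ, (lumpU γ n k₀ q.1 q.2 t : ℂ) * residue (mu γ n k₀ q.1 q.2 t) kα

end

end KPLump

/-! Write `E = exp(iθ(k₀))`, `p = p_n`, `F = F_n`, `ζ = iθ'(k₀)`. The generating series of the `p_m`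
is `exp(iθ(k₀ + X) - iθ(k₀))`, so `∂_x` and `∂_y` act on it as multiplication by `iX` and `i(2k₀X +
X²)`. All differential identities thereby become algebra in `ℂ⟦X⟧`. With `S = (i/2b)X` standing for
`∂_x/2b`, put `R = (1 - S)⁻¹`. Then `F = ∑_m |(SR)^m R p|²`, because `|q|² - ∂_x|q|²/2b = |q -
q_x/2b|² - |q_x/2b|²` makes the sum telescope to `|p|²`. Hence `F` has a positive lower bound, its
derivatives are explicit, and `F ~ |ζ|^{2n}/n!²` at infinity (`lumpF_ge`, `isSymbol_lumpF_sub`,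
`exists_le_lumpF`).

For (i), both integrals in the Darboux transform have elementary antiderivatives: `τ = |E|²F/2b`
(`tau_eq`), and `∫ e^{iθ(k)} φ̄_n` is a finite geometric sum (`integral_wave_mul_conj_phi`). What
remains is a rational identity.

For (ii) and (iii), partial fractions (`mu_eq`) give the coefficients `N_j = χ g_j` at `k̄₀`, where
`χ = p/F` and `g_j` is the conjugate of `R p_{n-j}`, and the residue `i F_x/F - N_1` at `k₀`. The
direct computation `uχ = iχ_y - χ_xx - 2i k̄₀ χ_x` leads to `u N_j = i∂_y N_j - ∂_x² N_j - 2i k̄₀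
∂_x N_j - 2i ∂_x N_{j+1}`, a divergence. A symbol calculus on the plane shows that `N_j` is of order
`-j` and that each derivative lowers the order by one. If `j ≥ 2`, the flux at infinity vanishes,
and so does the integral.

For `j = 1` the decay is borderline. Subtracting `n ζ/(1 + |ζ|²)` leaves a term of order `-2`, which
contributes nothing. The operator `i∂_y - 2i k̄₀ ∂_x` is `-4ib ∂_ζ`, so the subtracted part
contributes `-4ib n ∬ (1 + |ζ|²)⁻² dx dy = -2πi n`, as the Jacobian of `(x, y) ↦ ζ` is `2b` in
absolute value and the integral over the `ζ`-plane is `π`. Finally `u = 2∂_x(F_x/F)`, so `u · iF_x/F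
= i ∂_x((F_x/F)²)` integrates to zero, and the residue at `k₀` gives the opposite value `2πi n`. -/

namespace KPLump

open Complex MeasureTheory Filter Topology

noncomputable section

open PowerSeries (coeff)

/-! ### Formal Taylor series and the generating series of the Schur polynomials -/

/-- The Taylor series of `f` at `c`, in the variable `κ - c`. -/
def taylorSeries (f : ℂ → ℂ) (c : ℂ) : PowerSeries ℂ :=
  PowerSeries.mk fun m => iteratedDeriv m f c / m.factorial

theorem taylorSeries_congr {f g : ℂ → ℂ} {c : ℂ} (h : f =ᶠ[𝓝 c] g) :
    taylorSeries f c = taylorSeries g c := by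
  ext m
  simp [taylorSeries, h.iteratedDeriv_eq]

theorem taylorSeries_add {f g : ℂ → ℂ} {c : ℂ} (hf : AnalyticAt ℂ f c) (hg : AnalyticAt ℂ g c) :
    taylorSeries (fun κ => f κ + g κ) c = taylorSeries f c + taylorSeries g c := by
  ext m
  simp only [taylorSeries, PowerSeries.coeff_mk, map_add]
  rw [iteratedDeriv_fun_add hf.contDiffAt hg.contDiffAt, add_div]

theorem taylorSeries_mul {f g : ℂ → ℂ} {c : ℂ} (hf : AnalyticAt ℂ f c) (hg : AnalyticAt ℂ g c) :
    taylorSeries (fun κ => f κ * g κ) c = taylorSeries f c * taylorSeries g c := by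
  ext m
  rw [PowerSeries.coeff_mul, Finset.Nat.sum_antidiagonal_eq_sum_range_succ_mk]
  simp only [taylorSeries, PowerSeries.coeff_mk]
  rw [iteratedDeriv_fun_mul hf.contDiffAt hg.contDiffAt, Finset.sum_div]
  refine Finset.sum_congr rfl fun i hi => ?_
  rw [Nat.cast_choose ℂ (Nat.lt_succ_iff.mp (Finset.mem_range.mp hi))]
  have h1 := Nat.factorial_ne_zero m
  have h2 := Nat.factorial_ne_zero i
  have h3 := Nat.factorial_ne_zero (m - i)
  field_simp

theorem taylorSeries_deriv (f : ℂ → ℂ) (c : ℂ) :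
    taylorSeries (deriv f) c = PowerSeries.derivative ℂ (taylorSeries f c) := by
  ext m
  rw [PowerSeries.coeff_derivative]
  simp only [taylorSeries, PowerSeries.coeff_mk, iteratedDeriv_succ', Nat.factorial_succ]
  have h1 := Nat.factorial_ne_zero m
  have h2 : (m : ℂ) + 1 ≠ 0 := Nat.cast_add_one_ne_zero m
  push_cast
  field_simp

theorem taylorSeries_const (a c : ℂ) : taylorSeries (fun _ => a) c = PowerSeries.C a := by
  ext m
  rcases m with _ | m <;> simp [taylorSeries, iteratedDeriv_const, PowerSeries.coeff_C]

theorem taylorSeries_id (c : ℂ) :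
    taylorSeries (fun κ => κ) c = PowerSeries.C c + PowerSeries.X := by
  ext m
  rcases m with _ | _ | m <;>
    simp [taylorSeries, iteratedDeriv_fun_id, PowerSeries.coeff_X]

theorem analyticAt_theta {γ : ℂ → ℂ} {k₀ : ℂ} (hγ : AnalyticAt ℂ γ k₀) (x y t : ℝ) :
    AnalyticAt ℂ (fun κ => theta γ κ x y t) k₀ := by
  unfold theta
  fun_prop

/-- The generating series of the generalized Schur polynomials. -/
def schurSeries (γ : ℂ → ℂ) (k₀ : ℂ) (t x y : ℝ) : PowerSeries ℂ :=
  PowerSeries.mk fun m => schurP γ m k₀ x y t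

theorem schurSeries_eq (γ : ℂ → ℂ) (k₀ : ℂ) (t x y : ℝ) :
    schurSeries γ k₀ t x y = PowerSeries.C (exp (-(I * theta γ k₀ x y t))) *
      taylorSeries (fun κ => exp (I * theta γ κ x y t)) k₀ := by
  ext m
  rw [PowerSeries.coeff_C_mul]
  simp only [schurSeries, schurP, phi, taylorSeries, PowerSeries.coeff_mk]
  ring

theorem schurP_zero (γ : ℂ → ℂ) (k₀ : ℂ) (x y t : ℝ) : schurP γ 0 k₀ x y t = 1 := by
  simp [schurP, phi, ← Complex.exp_add]

/-- The formal derivative of the Taylor series of `iθ` at `k₀`. -/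
def phaseSeries (γ : ℂ → ℂ) (k₀ : ℂ) (t x y : ℝ) : PowerSeries ℂ :=
  PowerSeries.derivative ℂ (taylorSeries (fun κ => I * theta γ κ x y t) k₀)

/-- The equation `E' = (iθ)' E` near `k₀`, transported to Taylor series; the normalising constant
`exp(-iθ(k₀))` commutes with everything. -/
theorem derivative_schurSeries {γ : ℂ → ℂ} {k₀ : ℂ} (hγ : AnalyticAt ℂ γ k₀) (t x y : ℝ) :
    PowerSeries.derivative ℂ (schurSeries γ k₀ t x y) =
      phaseSeries γ k₀ t x y * schurSeries γ k₀ t x y := by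
  have hθ : AnalyticAt ℂ (fun κ => I * theta γ κ x y t) k₀ :=
    analyticAt_const.mul (analyticAt_theta hγ x y t)
  have hE : AnalyticAt ℂ (fun κ => exp (I * theta γ κ x y t)) k₀ := hθ.cexp
  have hd : deriv (fun κ => exp (I * theta γ κ x y t)) =ᶠ[𝓝 k₀]
      fun κ => deriv (fun κ => I * theta γ κ x y t) κ * exp (I * theta γ κ x y t) := by
    filter_upwards [hθ.eventually_analyticAt] with κ hκ
    rw [deriv_cexp hκ.differentiableAt, mul_comm]
  rw [schurSeries_eq, Derivation.leibniz, PowerSeries.derivative_C, smul_zero, add_zero,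
    ← taylorSeries_deriv, taylorSeries_congr hd, taylorSeries_mul hθ.deriv hE, taylorSeries_deriv,
    smul_eq_mul, phaseSeries]
  ring

theorem phaseSeries_eq {γ : ℂ → ℂ} {k₀ : ℂ} (hγ : AnalyticAt ℂ γ k₀) (t x y : ℝ) :
    phaseSeries γ k₀ t x y = phaseSeries γ k₀ t 0 0 + PowerSeries.C (I * x) +
      PowerSeries.C (2 * I * y) * (PowerSeries.C k₀ + PowerSeries.X) := by
  have h : (fun κ => I * theta γ κ x y t) = fun κ =>
      I * theta γ κ 0 0 t + ((I * x) * κ + (I * y) * (κ * κ)) := by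
    ext κ; simp only [theta]; push_cast; ring
  have h1 : AnalyticAt ℂ (fun κ : ℂ => κ) k₀ := analyticAt_id
  have h2 : AnalyticAt ℂ (fun κ : ℂ => κ * κ) k₀ := h1.mul h1
  have e : phaseSeries γ k₀ t x y = PowerSeries.derivative ℂ
      (taylorSeries (fun κ => I * theta γ κ x y t) k₀) := rfl
  have h3 : AnalyticAt ℂ (fun κ : ℂ => I * x * κ) k₀ := analyticAt_const.mul h1
  have h4 : AnalyticAt ℂ (fun κ : ℂ => I * y * (κ * κ)) k₀ := analyticAt_const.mul h2
  have h5 : AnalyticAt ℂ (fun κ => I * theta γ κ 0 0 t) k₀ :=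
    analyticAt_const.mul (analyticAt_theta hγ 0 0 t)
  have h6 : AnalyticAt ℂ (fun κ : ℂ => I * x * κ + I * y * (κ * κ)) k₀ := h3.add h4
  rw [e, h, taylorSeries_add h5 h6, taylorSeries_add h3 h4,
    taylorSeries_mul analyticAt_const h1, taylorSeries_mul analyticAt_const h2,
    taylorSeries_mul h1 h1, taylorSeries_const, taylorSeries_const, taylorSeries_id]
  simp only [map_add, Derivation.leibniz, PowerSeries.derivative_C, PowerSeries.derivative_X,
    smul_eq_mul, phaseSeries]
  rw [show 2 * I * (y : ℂ) = (I * y) + (I * y) by ring, map_add]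
  ring

/-! ### Derivatives in `x` and `y` as multiplication of the generating series -/

/-- A coefficientwise solution `P(s)` of `dP/dX = W(s) P` with constant term `1`,
where `W` evolves by
`dW/ds = dV/dX`, evolves by `dP/ds = V P`. -/
theorem hasDerivAt_coeff_of_derivative_eq {P W : ℝ → PowerSeries ℂ} {V : PowerSeries ℂ} {s : ℝ}
    (hP : ∀ s, PowerSeries.derivative ℂ (P s) = W s * P s) (hP0 : ∀ s, coeff 0 (P s) = 1)
    (hV0 : coeff 0 V = 0)
    (hW : ∀ i, HasDerivAt (fun s => coeff i (W s)) (coeff i (PowerSeries.derivative ℂ V)) s)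
    (m : ℕ) : HasDerivAt (fun s => coeff m (P s)) (coeff m (V * P s)) s := by
  induction m using Nat.strong_induction_on with
  | _ m ih =>
  rcases m with _ | m
  · simp only [hP0]
    refine (hasDerivAt_const s (1 : ℂ)).congr_deriv ?_
    rw [PowerSeries.coeff_zero_eq_constantCoeff] at hV0
    simp [hV0]
  · have hm : (m : ℂ) + 1 ≠ 0 := Nat.cast_add_one_ne_zero m
    have key : ∀ Q : PowerSeries ℂ,
        coeff (m + 1) Q = coeff m (PowerSeries.derivative ℂ Q) / (m + 1) := by
      intro Q
      rw [PowerSeries.coeff_derivative]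
      field_simp
    -- The equation in `X` gives coefficient `m + 1` of `P` from coefficients up to `m`, so the
    -- induction hypothesis applies. The resulting derivative `V'P + W V P` is `d/dX (V P)`, because
    -- `P' = W P`.
    have hsum : HasDerivAt (fun s => coeff m (W s * P s))
        (coeff m (PowerSeries.derivative ℂ V * P s + W s * (V * P s))) s := by
      simp only [map_add, PowerSeries.coeff_mul m]
      rw [← Finset.sum_add_distrib]
      refine HasDerivAt.fun_sum fun ij hij => (hW ij.1).mul (ih ij.2 ?_)
      have := Finset.HasAntidiagonal.mem_antidiagonal.mp hij
      omega
    have h2 := hsum.div_const ((m : ℂ) + 1)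
    have e1 : (fun s => coeff (m + 1) (P s)) = fun s => coeff m (W s * P s) / ((m : ℂ) + 1) := by
      ext s; rw [key, hP]
    rw [e1, key, Derivation.leibniz, hP, smul_eq_mul, smul_eq_mul]
    refine h2.congr_deriv ?_
    ring_nf

/-- The coefficient of `X ^ n` in `U P`, for the generating series `P` of the Schur polynomials. -/
def schurCoeff (γ : ℂ → ℂ) (n : ℕ) (k₀ : ℂ) (t : ℝ) (U : PowerSeries ℂ) (x y : ℝ) : ℂ :=
  coeff n (U * schurSeries γ k₀ t x y)

theorem hasDerivAt_coeff_mul {P : ℝ → PowerSeries ℂ} {V U : PowerSeries ℂ} {s : ℝ}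
    (h : ∀ m, HasDerivAt (fun s => coeff m (P s)) (coeff m (V * P s)) s) (n : ℕ) :
    HasDerivAt (fun s => coeff n (U * P s)) (coeff n (V * U * P s)) s := by
  rw [show V * U * P s = U * (V * P s) by ring]
  simp only [PowerSeries.coeff_mul n]
  exact HasDerivAt.fun_sum fun ij _ => (h ij.2).const_mul _

/-- Since `P = exp(iθ(k₀ + X) - iθ(k₀))`, the factor is the `x`-coefficient `iX` of the exponent. It
has no constant term because `p_0 = 1` is kept fixed. -/
theorem hasDerivAt_schurCoeff_fst {γ : ℂ → ℂ} {k₀ : ℂ} (hγ : AnalyticAt ℂ γ k₀) (n : ℕ) (t : ℝ)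
    (U : PowerSeries ℂ) (x y : ℝ) :
    HasDerivAt (fun s => schurCoeff γ n k₀ t U s y)
      (schurCoeff γ n k₀ t (PowerSeries.C I * PowerSeries.X * U) x y) x := by
  refine hasDerivAt_coeff_mul (P := fun s => schurSeries γ k₀ t s y) (fun m =>
    hasDerivAt_coeff_of_derivative_eq (W := fun s => phaseSeries γ k₀ t s y)
      (fun s => derivative_schurSeries hγ t s y) (fun s => ?_) ?_ (fun i => ?_) m) n
  · simp only [schurSeries, PowerSeries.coeff_mk, schurP_zero]
  · simp
  · have e : (fun s : ℝ => coeff i (phaseSeries γ k₀ t s y)) = fun s : ℝ =>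
        (coeff i (phaseSeries γ k₀ t 0 y)) + s * coeff i (PowerSeries.C I) := by
      ext s
      rw [phaseSeries_eq hγ t s y, phaseSeries_eq hγ t 0 y, map_mul PowerSeries.C I,
        mul_comm (PowerSeries.C I)]
      simp only [map_add, PowerSeries.coeff_C_mul]
      simp
      ring
    rw [e]
    have h := (((hasDerivAt_id x).ofReal_comp).mul_const (coeff i (PowerSeries.C I))).const_add
      (coeff i (phaseSeries γ k₀ t 0 y))
    refine h.congr_deriv ?_
    simp [Derivation.leibniz]

/-- Here the factor is `i((k₀ + X)² - k₀²)`, the `y`-coefficient of the exponent. -/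
theorem hasDerivAt_schurCoeff_snd {γ : ℂ → ℂ} {k₀ : ℂ} (hγ : AnalyticAt ℂ γ k₀) (n : ℕ) (t : ℝ)
    (U : PowerSeries ℂ) (x y : ℝ) :
    HasDerivAt (fun s => schurCoeff γ n k₀ t U x s)
      (schurCoeff γ n k₀ t
        (PowerSeries.C I * (PowerSeries.C (2 * k₀) * PowerSeries.X + PowerSeries.X ^ 2) * U) x y)
      y := by
  refine hasDerivAt_coeff_mul (P := fun s => schurSeries γ k₀ t x s) (fun m =>
    hasDerivAt_coeff_of_derivative_eq (W := fun s => phaseSeries γ k₀ t x s)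
      (fun s => derivative_schurSeries hγ t x s) (fun s => ?_) ?_ (fun i => ?_) m) n
  · simp only [schurSeries, PowerSeries.coeff_mk, schurP_zero]
  · simp
  · have e : (fun s : ℝ => coeff i (phaseSeries γ k₀ t x s)) = fun s : ℝ =>
        (coeff i (phaseSeries γ k₀ t x 0)) +
          s * coeff i (PowerSeries.C (2 * I) * (PowerSeries.C k₀ + PowerSeries.X)) := by
      ext s
      rw [phaseSeries_eq hγ t x s, phaseSeries_eq hγ t x 0, map_mul PowerSeries.C (2 * I),
        mul_comm (PowerSeries.C (2 * I)), mul_assoc]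
      simp only [map_add, PowerSeries.coeff_C_mul]
      simp
    rw [e]
    have h := (((hasDerivAt_id y).ofReal_comp).mul_const
      (coeff i (PowerSeries.C (2 * I) * (PowerSeries.C k₀ + PowerSeries.X)))).const_add
      (coeff i (phaseSeries γ k₀ t x 0))
    refine h.congr_deriv ?_
    simp only [Derivation.leibniz, map_add, PowerSeries.derivative_C, PowerSeries.derivative_X,
      smul_eq_mul, Derivation.leibniz_pow, ofReal_one, one_mul, map_mul]
    rw [← map_add]
    congr 1
    rw [show PowerSeries.C (2 : ℂ) = 2 from rfl]
    simp
    ring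

theorem schurCoeff_one (γ : ℂ → ℂ) (n : ℕ) (k₀ : ℂ) (t x y : ℝ) :
    schurCoeff γ n k₀ t 1 x y = schurP γ n k₀ x y t := by
  simp [schurCoeff, schurSeries]

theorem schurCoeff_add (γ : ℂ → ℂ) (n : ℕ) (k₀ : ℂ) (t : ℝ) (U V : PowerSeries ℂ) (x y : ℝ) :
    schurCoeff γ n k₀ t (U + V) x y = schurCoeff γ n k₀ t U x y + schurCoeff γ n k₀ t V x y := by
  simp [schurCoeff, add_mul]

theorem schurCoeff_C_mul (γ : ℂ → ℂ) (n : ℕ) (k₀ : ℂ) (t : ℝ) (c : ℂ) (U : PowerSeries ℂ)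
    (x y : ℝ) :
    schurCoeff γ n k₀ t (PowerSeries.C c * U) x y = c * schurCoeff γ n k₀ t U x y := by
  simp [schurCoeff, mul_assoc]

theorem schurCoeff_X_pow_mul_of_le (γ : ℂ → ℂ) {n j : ℕ} (k₀ : ℂ) (t : ℝ) (U : PowerSeries ℂ)
    (x y : ℝ) (h : j ≤ n) :
    schurCoeff γ n k₀ t (PowerSeries.X ^ j * U) x y = schurCoeff γ (n - j) k₀ t U x y := by
  rw [schurCoeff, mul_assoc, PowerSeries.coeff_X_pow_mul', if_pos h, schurCoeff]

theorem schurCoeff_X_pow_mul_of_lt (γ : ℂ → ℂ) {n j : ℕ} (k₀ : ℂ) (t : ℝ) (U : PowerSeries ℂ)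
    (x y : ℝ) (h : n < j) :
    schurCoeff γ n k₀ t (PowerSeries.X ^ j * U) x y = 0 := by
  rw [schurCoeff, mul_assoc, PowerSeries.coeff_X_pow_mul', if_neg (by omega)]

/-- The degree recurrence of the Schur polynomials. -/
theorem succ_mul_schurP {γ : ℂ → ℂ} {k₀ : ℂ} (hγ : AnalyticAt ℂ γ k₀) (t x y : ℝ) (m : ℕ) :
    ((m : ℂ) + 1) * schurP γ (m + 1) k₀ x y t =
      ∑ i ∈ Finset.range (m + 1),
        coeff i (phaseSeries γ k₀ t x y) * schurP γ (m - i) k₀ x y t := by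
  have h := congrArg (coeff m) (derivative_schurSeries hγ t x y)
  rw [PowerSeries.coeff_derivative, PowerSeries.coeff_mul,
    Finset.Nat.sum_antidiagonal_eq_sum_range_succ_mk] at h
  simp only [schurSeries, PowerSeries.coeff_mk] at h
  rw [← h]
  ring

theorem contDiff_schurCoeff {γ : ℂ → ℂ} {k₀ : ℂ} (hγ : AnalyticAt ℂ γ k₀) (n : ℕ) (t y : ℝ)
    (N : ℕ) (U : PowerSeries ℂ) : ContDiff ℝ N (fun s => schurCoeff γ n k₀ t U s y) := by
  induction N generalizing U with
  | zero =>
    exact contDiff_zero.mpr (continuous_iff_continuousAt.mpr fun x =>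
      (hasDerivAt_schurCoeff_fst hγ n t U x y).continuousAt)
  | succ N ih =>
    push_cast
    rw [contDiff_succ_iff_deriv]
    refine ⟨fun x => (hasDerivAt_schurCoeff_fst hγ n t U x y).differentiableAt, by simp, ?_⟩
    rw [show deriv (fun s => schurCoeff γ n k₀ t U s y) = fun s => _ from
      funext fun x => (hasDerivAt_schurCoeff_fst hγ n t U x y).deriv]
    exact ih _

theorem hasDerivAt_re_mul_conj {f g : ℝ → ℂ} {f' g' : ℂ} {s : ℝ} (hf : HasDerivAt f f' s)
    (hg : HasDerivAt g g' s) :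
    HasDerivAt (fun s => (f s * star (g s)).re) ((f' * star (g s)).re + (f s * star g').re) s := by
  have h := Complex.reCLM.hasFDerivAt.comp_hasDerivAt s (hf.mul hg.star)
  refine h.congr_deriv ?_
  simp

theorem contDiff_re_mul_conj {f g : ℝ → ℂ} {N : ℕ} (hf : ContDiff ℝ N f) (hg : ContDiff ℝ N g) :
    ContDiff ℝ N (fun s => (f s * star (g s)).re) :=
  Complex.reCLM.contDiff.comp (hf.mul (Complex.conjCLE.contDiff.comp hg))

/-- By the Leibniz rule each derivative puts one more `X` on one of the two factors. As soon as the
exponents add up to more than `2n`, one of them exceeds `n` and that factor has no coefficient of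
`X^n`. -/
theorem iteratedDeriv_re_mul_conj_eq_zero {γ : ℂ → ℂ} {k₀ : ℂ} (hγ : AnalyticAt ℂ γ k₀) (n : ℕ)
    (t y : ℝ) (N : ℕ) (a c : ℕ) (h : 2 * n < N + a + c) (U V : PowerSeries ℂ) (x : ℝ) :
    iteratedDeriv N (fun s => (schurCoeff γ n k₀ t (PowerSeries.X ^ a * U) s y *
      star (schurCoeff γ n k₀ t (PowerSeries.X ^ c * V) s y)).re) x = 0 := by
  induction N generalizing a c U V with
  | zero =>
    rw [iteratedDeriv_zero]
    rcases lt_or_ge n a with ha | ha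
    · simp [schurCoeff_X_pow_mul_of_lt γ k₀ t U x y ha]
    · simp [schurCoeff_X_pow_mul_of_lt γ k₀ t V x y (show n < c by omega)]
  | succ N ih =>
    rw [iteratedDeriv_succ']
    have e : ∀ (j : ℕ) (Q : PowerSeries ℂ), PowerSeries.C I * PowerSeries.X *
        (PowerSeries.X ^ j * Q) = PowerSeries.X ^ (j + 1) * (PowerSeries.C I * Q) := by
      intro j Q; ring
    have hd : deriv (fun s => (schurCoeff γ n k₀ t (PowerSeries.X ^ a * U) s y *
        star (schurCoeff γ n k₀ t (PowerSeries.X ^ c * V) s y)).re) = fun s =>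
        (schurCoeff γ n k₀ t (PowerSeries.X ^ (a + 1) * (PowerSeries.C I * U)) s y *
          star (schurCoeff γ n k₀ t (PowerSeries.X ^ c * V) s y)).re +
        (schurCoeff γ n k₀ t (PowerSeries.X ^ a * U) s y * star (schurCoeff γ n k₀ t
          (PowerSeries.X ^ (c + 1) * (PowerSeries.C I * V)) s y)).re := by
      ext s
      rw [(hasDerivAt_re_mul_conj (hasDerivAt_schurCoeff_fst hγ n t _ s y)
        (hasDerivAt_schurCoeff_fst hγ n t _ s y)).deriv, e, e]
    rw [hd, iteratedDeriv_fun_add, ih _ _ (by omega), ih _ _ (by omega), add_zero]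
    all_goals
      exact (contDiff_re_mul_conj (contDiff_schurCoeff hγ n t y N _)
        (contDiff_schurCoeff hγ n t y N _)).contDiffAt

/-! ### `F_n` as a sum of squares, and its derivatives -/

/-- If `G - G'/c = f` and `G` has vanishing derivative of order `N`, then
`G = ∑_{j<N} f^{(j)} / c^j`. -/
theorem sum_iteratedDeriv_div_pow_eq {f G : ℝ → ℝ} {c : ℝ} (hc : c ≠ 0) {N : ℕ}
    (hG : ContDiff ℝ N G) (h : ∀ x, f x = G x - deriv G x / c) (hN : ∀ x, iteratedDeriv N G x = 0)
    (x : ℝ) : ∑ j ∈ Finset.range N, iteratedDeriv j f x / c ^ j = G x := by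
  -- Differentiating `f = G - G'/c` makes the sum telescope; the last term dies by `hN`.
  have key : ∀ j ∈ Finset.range N, iteratedDeriv j f x / c ^ j =
      iteratedDeriv j G x / c ^ j - iteratedDeriv (j + 1) G x / c ^ (j + 1) := by
    intro j hj
    have hj : j + 1 ≤ N := Finset.mem_range.mp hj
    have hd : ContDiff ℝ j (deriv G) := by
      have h1 : ContDiff ℝ ((j : WithTop ℕ∞) + 1) G := hG.of_le (by exact_mod_cast hj)
      exact (contDiff_succ_iff_deriv.mp h1).2.2
    rw [show f = fun x => G x - deriv G x / c from funext h,
      iteratedDeriv_fun_sub (hG.of_le (by exact_mod_cast (by omega : j ≤ N))).contDiffAt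
        (hd.div_const c).contDiffAt, iteratedDeriv_div_const, ← iteratedDeriv_succ']
    field_simp
    ring
  rw [Finset.sum_congr rfl key, Finset.sum_range_sub', hN]
  simp

/-- The formal series `(i/2b) X`, which acts as `∂_x / 2b` on Schur polynomials. -/
def shiftSeries (k₀ : ℂ) : PowerSeries ℂ :=
  PowerSeries.C (I / (2 * (k₀.im : ℂ))) * PowerSeries.X

/-- The formal resolvent `(1 - ∂_x / 2b)⁻¹`. -/
def resolventSeries (k₀ : ℂ) : PowerSeries ℂ := (1 - shiftSeries k₀)⁻¹

theorem one_sub_shift_mul_resolvent (k₀ : ℂ) :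
    (1 - shiftSeries k₀) * resolventSeries k₀ = 1 :=
  PowerSeries.mul_inv_cancel _ (by simp [shiftSeries])

/-- `(∂_x/2b)^m (1 - ∂_x/2b)^{-m}` applied to `p_n`. -/
def cayleyCoeff (γ : ℂ → ℂ) (n : ℕ) (k₀ : ℂ) (t : ℝ) (m : ℕ) (x y : ℝ) : ℂ :=
  schurCoeff γ n k₀ t ((shiftSeries k₀ * resolventSeries k₀) ^ m) x y

theorem cayleyCoeff_zero (γ : ℂ → ℂ) (n : ℕ) (k₀ : ℂ) (t x y : ℝ) :
    cayleyCoeff γ n k₀ t 0 x y = schurP γ n k₀ x y t := by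
  rw [cayleyCoeff, pow_zero, schurCoeff_one]

theorem cayleyCoeff_of_lt (γ : ℂ → ℂ) {n : ℕ} (k₀ : ℂ) (t : ℝ) {m : ℕ} (h : n < m) (x y : ℝ) :
    cayleyCoeff γ n k₀ t m x y = 0 := by
  rw [cayleyCoeff, show (shiftSeries k₀ * resolventSeries k₀) ^ m = PowerSeries.X ^ m *
    (PowerSeries.C (I / (2 * (k₀.im : ℂ))) * resolventSeries k₀) ^ m by rw [shiftSeries]; ring]
  exact schurCoeff_X_pow_mul_of_lt _ _ _ _ _ _ h

/-- `∂_x/2b` applied to `cayleyCoeff m`. -/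
def cayleyShift (γ : ℂ → ℂ) (n : ℕ) (k₀ : ℂ) (t : ℝ) (m : ℕ) (x y : ℝ) : ℂ :=
  schurCoeff γ n k₀ t (shiftSeries k₀ * (shiftSeries k₀ * resolventSeries k₀) ^ m) x y

/-- With `(1 - S)R = 1` one has `1 + SR = R`, hence `S(1 + SR) = SR`. -/
theorem cayleyShift_add_succ (γ : ℂ → ℂ) (n : ℕ) (k₀ : ℂ) (t : ℝ) (m : ℕ) (x y : ℝ) :
    cayleyShift γ n k₀ t m x y + cayleyShift γ n k₀ t (m + 1) x y =
      cayleyCoeff γ n k₀ t (m + 1) x y := by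
  rw [cayleyShift, cayleyShift, ← schurCoeff_add, cayleyCoeff]
  congr 1
  have h := one_sub_shift_mul_resolvent k₀
  linear_combination (-shiftSeries k₀ * (shiftSeries k₀ * resolventSeries k₀) ^ m) * h

theorem cayleyShift_zero (γ : ℂ → ℂ) (n : ℕ) (k₀ : ℂ) (t x y : ℝ) :
    cayleyShift γ n k₀ t 0 x y =
      I / (2 * k₀.im) * schurCoeff γ n k₀ t PowerSeries.X x y := by
  rw [cayleyShift, pow_zero, mul_one, shiftSeries, schurCoeff_C_mul]

theorem C_I_mul_X {k₀ : ℂ} (hk₀ : 0 < k₀.im) :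
    PowerSeries.C I * PowerSeries.X = PowerSeries.C (2 * (k₀.im : ℂ)) * shiftSeries k₀ := by
  have : (k₀.im : ℂ) ≠ 0 := by exact_mod_cast hk₀.ne'
  rw [shiftSeries, ← mul_assoc, ← map_mul]
  congr 2
  field_simp

theorem C_I_mul_quadratic {k₀ : ℂ} (hk₀ : 0 < k₀.im) :
    PowerSeries.C I * (PowerSeries.C (2 * k₀) * PowerSeries.X + PowerSeries.X ^ 2) =
      PowerSeries.C (4 * k₀.im * k₀) * shiftSeries k₀ +
        PowerSeries.C (-4 * I * k₀.im ^ 2) * shiftSeries k₀ ^ 2 := by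
  have : (k₀.im : ℂ) ≠ 0 := by exact_mod_cast hk₀.ne'
  rw [shiftSeries, mul_pow, ← map_pow, ← mul_assoc, ← mul_assoc, ← map_mul, ← map_mul, mul_add,
    ← mul_assoc, ← map_mul]
  congr 3
  · field_simp
    ring
  · field_simp
    rw [I_sq]; ring

/-- The sum of two neighbours is `q_m = (SR)^m R p_n`, and `∂_x/2b` multiplies by `S`. -/
theorem hasDerivAt_cayley_add_fst {γ : ℂ → ℂ} {k₀ : ℂ} (hγ : AnalyticAt ℂ γ k₀) (hk₀ : 0 < k₀.im)
    (n m : ℕ) (t x y : ℝ) :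
    HasDerivAt (fun s => cayleyCoeff γ n k₀ t m s y + cayleyCoeff γ n k₀ t (m + 1) s y)
      (2 * k₀.im * cayleyCoeff γ n k₀ t (m + 1) x y) x := by
  have h := (hasDerivAt_schurCoeff_fst hγ n t ((shiftSeries k₀ * resolventSeries k₀) ^ m) x y).add
    (hasDerivAt_schurCoeff_fst hγ n t ((shiftSeries k₀ * resolventSeries k₀) ^ (m + 1)) x y)
  refine h.congr_deriv ?_
  rw [← cayleyShift_add_succ, C_I_mul_X hk₀, mul_assoc, mul_assoc, schurCoeff_C_mul,
    schurCoeff_C_mul, cayleyShift, cayleyShift]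
  ring

theorem hasDerivAt_cayley_add_snd {γ : ℂ → ℂ} {k₀ : ℂ} (hγ : AnalyticAt ℂ γ k₀) (hk₀ : 0 < k₀.im)
    (n m : ℕ) (t x y : ℝ) :
    HasDerivAt (fun s => cayleyCoeff γ n k₀ t m x s + cayleyCoeff γ n k₀ t (m + 1) x s)
      (4 * k₀.im * k₀ * cayleyCoeff γ n k₀ t (m + 1) x y -
        4 * I * k₀.im ^ 2 * cayleyShift γ n k₀ t (m + 1) x y) y := by
  have h := (hasDerivAt_schurCoeff_snd hγ n t ((shiftSeries k₀ * resolventSeries k₀) ^ m) x y).add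
    (hasDerivAt_schurCoeff_snd hγ n t ((shiftSeries k₀ * resolventSeries k₀) ^ (m + 1)) x y)
  refine h.congr_deriv ?_
  have h1 := one_sub_shift_mul_resolvent k₀
  rw [C_I_mul_quadratic hk₀, ← schurCoeff_add, cayleyCoeff, cayleyShift, sub_eq_add_neg,
    ← neg_mul, ← schurCoeff_C_mul, ← schurCoeff_C_mul, ← schurCoeff_add]
  congr 1
  rw [show -(4 * I * (k₀.im : ℂ) ^ 2) = -4 * I * k₀.im ^ 2 by ring]
  linear_combination (-(PowerSeries.C (4 * (k₀.im : ℂ) * k₀) * shiftSeries k₀ +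
    PowerSeries.C (-4 * I * (k₀.im : ℂ) ^ 2) * shiftSeries k₀ ^ 2) *
      (shiftSeries k₀ * resolventSeries k₀) ^ m) * h1

/-- `F_n` as a sum of squares. -/
def cayleySum (γ : ℂ → ℂ) (n : ℕ) (k₀ : ℂ) (t x y : ℝ) : ℝ :=
  ∑ m ∈ Finset.range (n + 1),
    ((cayleyCoeff γ n k₀ t m x y + cayleyCoeff γ n k₀ t (m + 1) x y) *
      star (cayleyCoeff γ n k₀ t m x y + cayleyCoeff γ n k₀ t (m + 1) x y)).re

/-- Each square satisfies `|q|² - ∂_x|q|²/2b = |q - q_x/2b|² - |q_x/2b|²`. For `q = q_m` the two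
terms on the right are the squares of consecutive Cayley coefficients, so the sum telescopes from
`|p_n|²` down to the vanishing coefficient of index `n + 1`. -/
theorem hasDerivAt_cayleySum_fst {γ : ℂ → ℂ} {k₀ : ℂ} (hγ : AnalyticAt ℂ γ k₀) (hk₀ : 0 < k₀.im)
    (n : ℕ) (t x y : ℝ) :
    HasDerivAt (fun s => cayleySum γ n k₀ t s y)
      (2 * k₀.im * (cayleySum γ n k₀ t x y - ‖schurP γ n k₀ x y t‖ ^ 2)) x := by
  have h := HasDerivAt.fun_sum (u := Finset.range (n + 1)) fun m _ =>
    hasDerivAt_re_mul_conj (hasDerivAt_cayley_add_fst hγ hk₀ n m t x y)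
      (hasDerivAt_cayley_add_fst hγ hk₀ n m t x y)
  refine h.congr_deriv ?_
  have e : ‖schurP γ n k₀ x y t‖ ^ 2 = ∑ m ∈ Finset.range (n + 1),
      (‖cayleyCoeff γ n k₀ t m x y‖ ^ 2 - ‖cayleyCoeff γ n k₀ t (m + 1) x y‖ ^ 2) := by
    rw [Finset.sum_range_sub', cayleyCoeff_of_lt γ k₀ t (Nat.lt_succ_self n), cayleyCoeff_zero]
    simp
  rw [e, cayleySum, ← Finset.sum_sub_distrib, Finset.mul_sum]
  refine Finset.sum_congr rfl fun m _ => ?_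
  rw [Complex.sq_norm, Complex.sq_norm]
  simp [Complex.normSq_apply]
  ring

/-- The linear part of the symbol `i(2k₀X + X²)` yields the term `2 Re k₀ · F_x`. The imaginary part
of `k₀` and the quadratic part of the symbol combine into a second telescoping sum, whose only
surviving term involves `p_{n-1} p̄_n`. -/
theorem hasDerivAt_cayleySum_snd {γ : ℂ → ℂ} {k₀ : ℂ} (hγ : AnalyticAt ℂ γ k₀) (hk₀ : 0 < k₀.im)
    (n : ℕ) (t x y : ℝ) :
    HasDerivAt (fun s => cayleySum γ n k₀ t x s)
      (2 * k₀.re * (2 * k₀.im * (cayleySum γ n k₀ t x y - ‖schurP γ n k₀ x y t‖ ^ 2)) -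
        4 * k₀.im * (schurCoeff γ n k₀ t PowerSeries.X x y * star (schurP γ n k₀ x y t)).re) y := by
  have h := HasDerivAt.fun_sum (u := Finset.range (n + 1)) fun m _ =>
    hasDerivAt_re_mul_conj (hasDerivAt_cayley_add_snd hγ hk₀ n m t x y)
      (hasDerivAt_cayley_add_snd hγ hk₀ n m t x y)
  have h1 := HasDerivAt.fun_sum (u := Finset.range (n + 1)) fun m _ =>
    hasDerivAt_re_mul_conj (hasDerivAt_cayley_add_fst hγ hk₀ n m t x y)
      (hasDerivAt_cayley_add_fst hγ hk₀ n m t x y)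
  refine h.congr_deriv ?_
  rw [(hasDerivAt_cayleySum_fst hγ hk₀ n t x y).unique h1, Finset.mul_sum]
  have e : 4 * k₀.im * (schurCoeff γ n k₀ t PowerSeries.X x y * star (schurP γ n k₀ x y t)).re =
      8 * k₀.im ^ 2 * ∑ m ∈ Finset.range (n + 1),
      ((cayleyShift γ n k₀ t m x y * star (cayleyCoeff γ n k₀ t m x y)).im -
        (cayleyShift γ n k₀ t (m + 1) x y * star (cayleyCoeff γ n k₀ t (m + 1) x y)).im) := by
    rw [Finset.sum_range_sub' fun m =>
      (cayleyShift γ n k₀ t m x y * star (cayleyCoeff γ n k₀ t m x y)).im,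
      cayleyCoeff_of_lt γ k₀ t (Nat.lt_succ_self n), cayleyCoeff_zero, cayleyShift_zero]
    rw [show I / (2 * (k₀.im : ℂ)) * schurCoeff γ n k₀ t PowerSeries.X x y *
      star (schurP γ n k₀ x y t) = ((1 / (2 * k₀.im) : ℝ) : ℂ) *
        (I * (schurCoeff γ n k₀ t PowerSeries.X x y * star (schurP γ n k₀ x y t))) by
          push_cast; ring, Complex.im_ofReal_mul, Complex.I_mul_im, star_zero, mul_zero, zero_im,
      sub_zero]
    field_simp
    ring
  rw [e, Finset.mul_sum, ← Finset.sum_sub_distrib]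
  refine Finset.sum_congr rfl fun m _ => ?_
  rw [← cayleyShift_add_succ γ n k₀ t m]
  simp [pow_two]
  ring

theorem contDiff_cayleySum {γ : ℂ → ℂ} {k₀ : ℂ} (hγ : AnalyticAt ℂ γ k₀) (n : ℕ) (t y : ℝ)
    (N : ℕ) : ContDiff ℝ N (fun s => cayleySum γ n k₀ t s y) :=
  ContDiff.sum fun _ _ => contDiff_re_mul_conj
    ((contDiff_schurCoeff hγ n t y N _).add (contDiff_schurCoeff hγ n t y N _))
    ((contDiff_schurCoeff hγ n t y N _).add (contDiff_schurCoeff hγ n t y N _))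

theorem iteratedDeriv_cayleySum_eq_zero {γ : ℂ → ℂ} {k₀ : ℂ} (hγ : AnalyticAt ℂ γ k₀) (n : ℕ)
    (t x y : ℝ) : iteratedDeriv (2 * n + 1) (fun s => cayleySum γ n k₀ t s y) x = 0 := by
  simp only [cayleySum, cayleyCoeff]
  rw [iteratedDeriv_fun_sum fun _ _ => (contDiff_re_mul_conj
    ((contDiff_schurCoeff hγ n t y _ _).add (contDiff_schurCoeff hγ n t y _ _))
    ((contDiff_schurCoeff hγ n t y _ _).add (contDiff_schurCoeff hγ n t y _ _))).contDiffAt]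
  refine Finset.sum_eq_zero fun m _ => ?_
  simp only [← schurCoeff_add]
  have := iteratedDeriv_re_mul_conj_eq_zero hγ n t y (2 * n + 1) 0 0 (by omega)
    ((shiftSeries k₀ * resolventSeries k₀) ^ m + (shiftSeries k₀ * resolventSeries k₀) ^ (m + 1))
    ((shiftSeries k₀ * resolventSeries k₀) ^ m + (shiftSeries k₀ * resolventSeries k₀) ^ (m + 1)) x
  simpa only [pow_zero, one_mul] using this

/-- Both sides invert `1 - ∂_x/2b` on `|p_n|²`. The finite Neumann series is exact because the
derivative of order `2n + 1` of the sum of squares vanishes. -/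
theorem lumpF_eq_cayleySum {γ : ℂ → ℂ} {k₀ : ℂ} (hγ : AnalyticAt ℂ γ k₀) (hk₀ : 0 < k₀.im) (n : ℕ)
    (t x y : ℝ) : lumpF γ n k₀ x y t = cayleySum γ n k₀ t x y := by
  refine sum_iteratedDeriv_div_pow_eq (by positivity) (contDiff_cayleySum hγ n t y _)
    (fun x' => ?_) (fun x' => iteratedDeriv_cayleySum_eq_zero hγ n t x' y) x
  rw [(hasDerivAt_cayleySum_fst hγ hk₀ n t x' y).deriv]
  field_simp
  ring

theorem schurCoeff_X_pow_self (γ : ℂ → ℂ) (n : ℕ) (k₀ : ℂ) (t : ℝ) (U : PowerSeries ℂ) (x y : ℝ) :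
    schurCoeff γ n k₀ t (PowerSeries.X ^ n * U) x y = PowerSeries.constantCoeff U := by
  rw [schurCoeff_X_pow_mul_of_le _ _ _ _ _ _ le_rfl, Nat.sub_self, schurCoeff,
    PowerSeries.coeff_zero_eq_constantCoeff, map_mul, ← PowerSeries.coeff_zero_eq_constantCoeff]
  simp [schurSeries, schurP_zero]

/-- The last square, `m = n`, is a constant: `X^n` leaves only `p_0 = 1`, and the scalar factor is
`(i/2b)^n`. -/
theorem lumpF_ge {γ : ℂ → ℂ} {k₀ : ℂ} (hγ : AnalyticAt ℂ γ k₀) (hk₀ : 0 < k₀.im) (n : ℕ)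
    (t x y : ℝ) : ((1 / (2 * k₀.im)) ^ n) ^ 2 ≤ lumpF γ n k₀ x y t := by
  rw [lumpF_eq_cayleySum hγ hk₀]
  have h : ∀ z : ℂ, (z * star z).re = ‖z‖ ^ 2 := by
    intro z; rw [Complex.sq_norm, Complex.normSq_apply]; simp
  refine le_trans ?_ (Finset.single_le_sum (f := fun m =>
    ((cayleyCoeff γ n k₀ t m x y + cayleyCoeff γ n k₀ t (m + 1) x y) *
      star (cayleyCoeff γ n k₀ t m x y + cayleyCoeff γ n k₀ t (m + 1) x y)).re)
    (fun m _ => by rw [h]; positivity) (Finset.self_mem_range_succ n))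
  rw [h, cayleyCoeff_of_lt γ k₀ t (Nat.lt_succ_self n), add_zero, cayleyCoeff,
    show (shiftSeries k₀ * resolventSeries k₀) ^ n = PowerSeries.X ^ n *
    (PowerSeries.C (I / (2 * (k₀.im : ℂ))) * resolventSeries k₀) ^ n by rw [shiftSeries]; ring,
    schurCoeff_X_pow_self]
  simp [resolventSeries, shiftSeries, abs_of_pos hk₀]

theorem lumpF_pos {γ : ℂ → ℂ} {k₀ : ℂ} (hγ : AnalyticAt ℂ γ k₀) (hk₀ : 0 < k₀.im) (n : ℕ)
    (t x y : ℝ) : 0 < lumpF γ n k₀ x y t :=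
  lt_of_lt_of_le (by positivity) (lumpF_ge hγ hk₀ n t x y)

theorem hasDerivAt_lumpF_fst {γ : ℂ → ℂ} {k₀ : ℂ} (hγ : AnalyticAt ℂ γ k₀) (hk₀ : 0 < k₀.im)
    (n : ℕ) (t x y : ℝ) :
    HasDerivAt (fun s => lumpF γ n k₀ s y t)
      (2 * k₀.im * (lumpF γ n k₀ x y t - ‖schurP γ n k₀ x y t‖ ^ 2)) x := by
  simpa only [lumpF_eq_cayleySum hγ hk₀] using hasDerivAt_cayleySum_fst hγ hk₀ n t x y

theorem hasDerivAt_lumpF_snd {γ : ℂ → ℂ} {k₀ : ℂ} (hγ : AnalyticAt ℂ γ k₀) (hk₀ : 0 < k₀.im)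
    (n : ℕ) (t x y : ℝ) :
    HasDerivAt (fun s => lumpF γ n k₀ x s t)
      (2 * k₀.re * (2 * k₀.im * (lumpF γ n k₀ x y t - ‖schurP γ n k₀ x y t‖ ^ 2)) -
        4 * k₀.im * (schurCoeff γ n k₀ t PowerSeries.X x y * star (schurP γ n k₀ x y t)).re) y := by
  simpa only [lumpF_eq_cayleySum hγ hk₀] using hasDerivAt_cayleySum_snd hγ hk₀ n t x y

/-! ### Symbol calculus on the plane -/

/-- The weight `1 + |(x, y)|` on the plane. -/
def weight (x y : ℝ) : ℝ := 1 + ‖((x, y) : ℝ × ℝ)‖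

theorem one_le_weight (x y : ℝ) : 1 ≤ weight x y := by
  unfold weight; linarith [norm_nonneg ((x, y) : ℝ × ℝ)]

theorem weight_pos (x y : ℝ) : 0 < weight x y := lt_of_lt_of_le one_pos (one_le_weight x y)

/-- Continuous functions on the plane of order at most `m` at infinity. -/
def IsOfOrder (m : ℤ) (f : ℝ → ℝ → ℂ) : Prop :=
  Continuous (fun q : ℝ × ℝ => f q.1 q.2) ∧ ∃ C : ℝ, ∀ x y, ‖f x y‖ ≤ C * weight x y ^ m

/-- Functions `f` on the plane with `k` partial derivatives, the derivatives of order `j ≤ k`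
being continuous and of order at most `m - j` at infinity. -/
def IsSymbol : ℕ → ℤ → (ℝ → ℝ → ℂ) → Prop
  | 0, m, f => IsOfOrder m f
  | k + 1, m, f => IsOfOrder m f ∧ ∃ fx fy : ℝ → ℝ → ℂ,
      (∀ x y, HasDerivAt (fun s => f s y) (fx x y) x) ∧
      (∀ x y, HasDerivAt (fun s => f x s) (fy x y) y) ∧
      IsSymbol k (m - 1) fx ∧ IsSymbol k (m - 1) fy

theorem IsSymbol.isOfOrder {k : ℕ} {m : ℤ} {f : ℝ → ℝ → ℂ} (h : IsSymbol k m f) :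
    IsOfOrder m f := by
  cases k with
  | zero => exact h
  | succ k => exact h.1

theorem IsSymbol.of_succ {k : ℕ} {m : ℤ} {f : ℝ → ℝ → ℂ} (h : IsSymbol (k + 1) m f) :
    IsSymbol k m f := by
  induction k generalizing m f with
  | zero => exact h.1
  | succ k ih =>
    obtain ⟨h0, fx, fy, hx, hy, h1, h2⟩ := h
    exact ⟨h0, fx, fy, hx, hy, ih h1, ih h2⟩

theorem IsSymbol.fst {k : ℕ} {m : ℤ} {f g : ℝ → ℝ → ℂ} (h : IsSymbol (k + 1) m f)
    (hg : ∀ x y, HasDerivAt (fun s => f s y) (g x y) x) : IsSymbol k (m - 1) g := by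
  obtain ⟨-, fx, fy, hx, -, h1, -⟩ := h
  rwa [show g = fx from funext₂ fun x y => (hg x y).unique (hx x y)]

theorem IsSymbol.snd {k : ℕ} {m : ℤ} {f g : ℝ → ℝ → ℂ} (h : IsSymbol (k + 1) m f)
    (hg : ∀ x y, HasDerivAt (fun s => f x s) (g x y) y) : IsSymbol k (m - 1) g := by
  obtain ⟨-, fx, fy, -, hy, -, h2⟩ := h
  rwa [show g = fy from funext₂ fun x y => (hg x y).unique (hy x y)]

theorem IsOfOrder.mono {m m' : ℤ} {f : ℝ → ℝ → ℂ} (hm : m ≤ m') (h : IsOfOrder m f) :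
    IsOfOrder m' f := by
  obtain ⟨hc, C, hC⟩ := h
  refine ⟨hc, |C|, fun x y => (hC x y).trans ?_⟩
  have h1 : weight x y ^ m ≤ weight x y ^ m' := zpow_le_zpow_right₀ (one_le_weight x y) hm
  have h2 : 0 < weight x y ^ m := zpow_pos (weight_pos x y) m
  exact (mul_le_mul_of_nonneg_right (le_abs_self C) h2.le).trans
    (mul_le_mul_of_nonneg_left h1 (abs_nonneg C))

theorem IsSymbol.mono {k : ℕ} {m m' : ℤ} {f : ℝ → ℝ → ℂ} (hm : m ≤ m') (h : IsSymbol k m f) :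
    IsSymbol k m' f := by
  induction k generalizing m m' f with
  | zero => exact IsOfOrder.mono hm h
  | succ k ih =>
    obtain ⟨h0, fx, fy, hx, hy, h1, h2⟩ := h
    exact ⟨h0.mono hm, fx, fy, hx, hy, ih (by omega) h1, ih (by omega) h2⟩

theorem isSymbol_zero (k : ℕ) (m : ℤ) : IsSymbol k m (fun _ _ => 0) := by
  have h0 : ∀ m, IsOfOrder m (fun _ _ => 0) := fun m => ⟨continuous_const, 0, by simp⟩
  induction k generalizing m with
  | zero => exact h0 m
  | succ k ih =>
    exact ⟨h0 m, _, _, fun x y => hasDerivAt_const x 0, fun x y => hasDerivAt_const y 0, ih _, ih _⟩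

theorem isSymbol_const (k : ℕ) (c : ℂ) : IsSymbol k 0 (fun _ _ => c) := by
  have h0 : IsOfOrder 0 (fun _ _ => c) := ⟨continuous_const, ‖c‖, by simp⟩
  cases k with
  | zero => exact h0
  | succ k =>
    exact ⟨h0, _, _, fun x y => hasDerivAt_const x c, fun x y => hasDerivAt_const y c,
      isSymbol_zero _ _, isSymbol_zero _ _⟩

theorem IsSymbol.add {k : ℕ} {m : ℤ} {f g : ℝ → ℝ → ℂ} (hf : IsSymbol k m f)
    (hg : IsSymbol k m g) : IsSymbol k m (fun x y => f x y + g x y) := by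
  have h0 : ∀ {m f g}, IsOfOrder m f → IsOfOrder m g → IsOfOrder m (fun x y => f x y + g x y) := by
    rintro m f g ⟨hc, C, hC⟩ ⟨hc', C', hC'⟩
    refine ⟨hc.add hc', C + C', fun x y => (norm_add_le _ _).trans ?_⟩
    rw [add_mul]
    exact add_le_add (hC x y) (hC' x y)
  induction k generalizing m f g with
  | zero => exact h0 hf hg
  | succ k ih =>
    obtain ⟨hf0, fx, fy, hfx, hfy, hf1, hf2⟩ := hf
    obtain ⟨hg0, gx, gy, hgx, hgy, hg1, hg2⟩ := hg
    exact ⟨h0 hf0 hg0, _, _, fun x y => (hfx x y).add (hgx x y), fun x y => (hfy x y).add (hgy x y),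
      ih hf1 hg1, ih hf2 hg2⟩

theorem IsOfOrder.mul {m m' : ℤ} {f g : ℝ → ℝ → ℂ} (hf : IsOfOrder m f) (hg : IsOfOrder m' g) :
    IsOfOrder (m + m') (fun x y => f x y * g x y) := by
  obtain ⟨hc, C, hC⟩ := hf
  obtain ⟨hc', C', hC'⟩ := hg
  refine ⟨hc.mul hc', C * C', fun x y => ?_⟩
  rw [norm_mul, zpow_add₀ (weight_pos x y).ne', mul_mul_mul_comm]
  exact mul_le_mul (hC x y) (hC' x y) (norm_nonneg _) ((norm_nonneg _).trans (hC x y))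

theorem IsSymbol.mul {k : ℕ} {m m' : ℤ} {f g : ℝ → ℝ → ℂ} (hf : IsSymbol k m f)
    (hg : IsSymbol k m' g) : IsSymbol k (m + m') (fun x y => f x y * g x y) := by
  induction k generalizing m m' f g with
  | zero => exact IsOfOrder.mul hf hg
  | succ k ih =>
    have hf' := hf.of_succ
    have hg' := hg.of_succ
    obtain ⟨hf0, fx, fy, hfx, hfy, hf1, hf2⟩ := hf
    obtain ⟨hg0, gx, gy, hgx, hgy, hg1, hg2⟩ := hg
    exact ⟨hf0.mul hg0, _, _, fun x y => (hfx x y).mul (hgx x y),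
      fun x y => (hfy x y).mul (hgy x y),
      ((ih hf1 hg').mono (by omega)).add ((ih hf' hg1).mono (by omega)),
      ((ih hf2 hg').mono (by omega)).add ((ih hf' hg2).mono (by omega))⟩

theorem IsSymbol.const_mul {k : ℕ} {m : ℤ} {f : ℝ → ℝ → ℂ} (c : ℂ) (hf : IsSymbol k m f) :
    IsSymbol k m (fun x y => c * f x y) := by
  simpa using (isSymbol_const k c).mul hf

theorem IsSymbol.neg {k : ℕ} {m : ℤ} {f : ℝ → ℝ → ℂ} (hf : IsSymbol k m f) :
    IsSymbol k m (fun x y => -f x y) := by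
  simpa using hf.const_mul (-1)

theorem IsSymbol.sub {k : ℕ} {m : ℤ} {f g : ℝ → ℝ → ℂ} (hf : IsSymbol k m f)
    (hg : IsSymbol k m g) : IsSymbol k m (fun x y => f x y - g x y) := by
  simpa only [sub_eq_add_neg] using hf.add hg.neg

theorem IsSymbol.sum {ι : Type*} {k : ℕ} {m : ℤ} (s : Finset ι) {f : ι → ℝ → ℝ → ℂ}
    (hf : ∀ i ∈ s, IsSymbol k m (f i)) : IsSymbol k m (fun x y => ∑ i ∈ s, f i x y) := by
  classical
  induction s using Finset.induction_on with
  | empty => simpa using isSymbol_zero k m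
  | insert a s ha ih =>
    simp only [Finset.sum_insert ha]
    exact (hf a (Finset.mem_insert_self a s)).add
      (ih fun i hi => hf i (Finset.mem_insert_of_mem hi))

theorem IsSymbol.star {k : ℕ} {m : ℤ} {f : ℝ → ℝ → ℂ} (hf : IsSymbol k m f) :
    IsSymbol k m (fun x y => star (f x y)) := by
  have h0 : ∀ {m f}, IsOfOrder m f → IsOfOrder m (fun x y => Star.star (f x y)) := by
    rintro m f ⟨hc, C, hC⟩
    exact ⟨hc.star, C, fun x y => by simpa using hC x y⟩
  induction k generalizing m f with
  | zero => exact h0 hf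
  | succ k ih =>
    obtain ⟨hf0, fx, fy, hfx, hfy, hf1, hf2⟩ := hf
    exact ⟨h0 hf0, _, _, fun x y => (hfx x y).star, fun x y => (hfy x y).star, ih hf1, ih hf2⟩

theorem IsSymbol.pow {k : ℕ} {m : ℤ} {f : ℝ → ℝ → ℂ} (hf : IsSymbol k m f) (j : ℕ) :
    IsSymbol k (j * m) (fun x y => f x y ^ j) := by
  induction j with
  | zero => simpa using isSymbol_const k 1
  | succ j ih =>
    simp only [pow_succ]
    exact (ih.mul hf).mono (by push_cast; linarith)

/-- Ellipticity from below bounds the inverse itself. Its derivatives are `-f' f⁻²`, so induction on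
the number of derivatives gives the right orders. -/
theorem IsSymbol.inv {k : ℕ} {m : ℤ} {f : ℝ → ℝ → ℂ} (hf : IsSymbol k m f) {c : ℝ} (hc : 0 < c)
    (h : ∀ x y, c * weight x y ^ m ≤ ‖f x y‖) : IsSymbol k (-m) (fun x y => (f x y)⁻¹) := by
  have hpos : ∀ x y, 0 < c * weight x y ^ m := fun x y => mul_pos hc (zpow_pos (weight_pos x y) m)
  have hne : ∀ x y, f x y ≠ 0 := fun x y h0 => by
    have := h x y
    rw [h0, norm_zero] at this
    exact absurd (hpos x y) (not_lt.mpr this)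
  have h0 : IsOfOrder (-m) (fun x y => (f x y)⁻¹) := by
    refine ⟨hf.isOfOrder.1.inv₀ fun q => hne q.1 q.2, c⁻¹, fun x y => ?_⟩
    rw [norm_inv, zpow_neg, ← mul_inv]
    exact inv_anti₀ (hpos x y) (h x y)
  induction k with
  | zero => exact h0
  | succ k ih =>
    have hi := ih hf.of_succ
    obtain ⟨hf0, fx, fy, hfx, hfy, hf1, hf2⟩ := hf
    have e : ∀ a b : ℂ, -a / b ^ 2 = -(a * (b⁻¹ * b⁻¹)) := by
      intro a b; rw [div_eq_mul_inv, pow_two, mul_inv, neg_mul]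
    refine ⟨h0, _, _, fun x y => (hfx x y).fun_inv (hne x y),
      fun x y => (hfy x y).fun_inv (hne x y),
      ?_, ?_⟩
    all_goals simp only [e]
    · exact ((hf1.mul (hi.mul hi)).mono (by omega)).neg
    · exact ((hf2.mul (hi.mul hi)).mono (by omega)).neg

theorem isSymbol_fst (k : ℕ) : IsSymbol k 1 (fun x _ => (x : ℂ)) := by
  have h0 : IsOfOrder 1 (fun x _ => (x : ℂ)) := by
    refine ⟨by fun_prop, 1, fun x y => ?_⟩
    rw [zpow_one, one_mul, weight, Complex.norm_real]
    linarith [norm_fst_le ((x, y) : ℝ × ℝ)]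
  cases k with
  | zero => exact h0
  | succ k =>
    refine ⟨h0, fun _ _ => 1, fun _ _ => 0, fun x y => by simpa using (hasDerivAt_id x).ofReal_comp,
      fun x y => hasDerivAt_const y _, ?_, isSymbol_zero _ _⟩
    exact isSymbol_const k 1

theorem isSymbol_snd (k : ℕ) : IsSymbol k 1 (fun _ y => (y : ℂ)) := by
  have h0 : IsOfOrder 1 (fun _ y => (y : ℂ)) := by
    refine ⟨by fun_prop, 1, fun x y => ?_⟩
    rw [zpow_one, one_mul, weight, Complex.norm_real]
    linarith [norm_snd_le ((x, y) : ℝ × ℝ)]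
  cases k with
  | zero => exact h0
  | succ k =>
    refine ⟨h0, fun _ _ => 0, fun _ _ => 1, fun x y => hasDerivAt_const x _,
      fun x y => by simpa using (hasDerivAt_id y).ofReal_comp, isSymbol_zero _ _, ?_⟩
    exact isSymbol_const k 1

/-! ### Orders and leading terms of `p_n` and `F_n` -/

/-- The linear phase `iθ'(k₀)`, the leading variable of the Schur polynomials. -/
def linPhase (γ : ℂ → ℂ) (k₀ : ℂ) (t x y : ℝ) : ℂ := coeff 0 (phaseSeries γ k₀ t x y)

theorem coeff_phaseSeries {γ : ℂ → ℂ} {k₀ : ℂ} (hγ : AnalyticAt ℂ γ k₀) (t : ℝ) (i : ℕ) (x y : ℝ) :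
    coeff i (phaseSeries γ k₀ t x y) = coeff i (phaseSeries γ k₀ t 0 0) +
      coeff i (PowerSeries.C I) * x +
      coeff i (PowerSeries.C (2 * I) * (PowerSeries.C k₀ + PowerSeries.X)) * y := by
  rw [phaseSeries_eq hγ, map_mul PowerSeries.C I, map_mul PowerSeries.C (2 * I),
    mul_comm (PowerSeries.C I), mul_comm (PowerSeries.C (2 * I)) (PowerSeries.C (y : ℂ)), mul_assoc]
  simp only [map_add, PowerSeries.coeff_C_mul]
  ring

theorem linPhase_eq {γ : ℂ → ℂ} {k₀ : ℂ} (hγ : AnalyticAt ℂ γ k₀) (t x y : ℝ) :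
    linPhase γ k₀ t x y = linPhase γ k₀ t 0 0 + I * x + 2 * I * k₀ * y := by
  rw [linPhase, coeff_phaseSeries hγ, linPhase, PowerSeries.coeff_zero_C, PowerSeries.coeff_C_mul,
    map_add, PowerSeries.coeff_zero_C, PowerSeries.coeff_zero_X, add_zero]

theorem isSymbol_coeff_phaseSeries {γ : ℂ → ℂ} {k₀ : ℂ} (hγ : AnalyticAt ℂ γ k₀) (t : ℝ)
    (k i : ℕ) : IsSymbol k 1 (fun x y => coeff i (phaseSeries γ k₀ t x y)) := by
  rw [show (fun x y => coeff i (phaseSeries γ k₀ t x y)) = _ from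
    funext₂ (coeff_phaseSeries hγ t i)]
  exact (((isSymbol_const k _).mono (by omega)).add ((isSymbol_fst k).const_mul _)).add
    ((isSymbol_snd k).const_mul _)

theorem isSymbol_linPhase {γ : ℂ → ℂ} {k₀ : ℂ} (hγ : AnalyticAt ℂ γ k₀) (t : ℝ) (k : ℕ) :
    IsSymbol k 1 (linPhase γ k₀ t) :=
  isSymbol_coeff_phaseSeries hγ t k 0

theorem schurP_succ {γ : ℂ → ℂ} {k₀ : ℂ} (hγ : AnalyticAt ℂ γ k₀) (t x y : ℝ) (m : ℕ) :
    schurP γ (m + 1) k₀ x y t = ((m : ℂ) + 1)⁻¹ * ∑ i ∈ Finset.range (m + 1),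
        coeff i (phaseSeries γ k₀ t x y) * schurP γ (m - i) k₀ x y t := by
  rw [← succ_mul_schurP hγ, inv_mul_cancel_left₀ (Nat.cast_add_one_ne_zero m)]

theorem isSymbol_schurP {γ : ℂ → ℂ} {k₀ : ℂ} (hγ : AnalyticAt ℂ γ k₀) (t : ℝ) (k m : ℕ) :
    IsSymbol k m (fun x y => schurP γ m k₀ x y t) := by
  induction m using Nat.strong_induction_on with
  | _ m ih =>
  rcases m with _ | m
  · simp only [schurP_zero]
    exact isSymbol_const k 1
  · simp only [schurP_succ hγ]
    refine (IsSymbol.sum _ fun i hi => ?_).const_mul _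
    have := Finset.mem_range.mp hi
    exact ((isSymbol_coeff_phaseSeries hγ t k i).mul (ih (m - i) (by omega))).mono (by omega)

/-- In the degree recurrence the term `i = 0` multiplies by the linear phase and carries the top
order. The terms `i ≥ 1` multiply a polynomial of degree at least one lower by a coefficient that is
only affine, so they lose one order. -/
theorem isSymbol_schurP_sub {γ : ℂ → ℂ} {k₀ : ℂ} (hγ : AnalyticAt ℂ γ k₀) (t : ℝ) (k m : ℕ) :
    IsSymbol k (m - 1) (fun x y =>
      schurP γ m k₀ x y t - linPhase γ k₀ t x y ^ m / m.factorial) := by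
  induction m with
  | zero =>
    simp only [schurP_zero, pow_zero, Nat.factorial_zero, Nat.cast_one, div_one, sub_self]
    exact isSymbol_zero k _
  | succ m ih =>
    have e : ∀ x y, schurP γ (m + 1) k₀ x y t -
        linPhase γ k₀ t x y ^ (m + 1) / (m + 1).factorial = ((m : ℂ) + 1)⁻¹ *
        (linPhase γ k₀ t x y * (schurP γ m k₀ x y t - linPhase γ k₀ t x y ^ m / m.factorial) +
          ∑ i ∈ Finset.range m,
            coeff (i + 1) (phaseSeries γ k₀ t x y) * schurP γ (m - (i + 1)) k₀ x y t) := by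
      intro x y
      have h1 : (m : ℂ) + 1 ≠ 0 := Nat.cast_add_one_ne_zero m
      have h2 : (m.factorial : ℂ) ≠ 0 := by exact_mod_cast m.factorial_ne_zero
      rw [schurP_succ hγ, Finset.sum_range_succ', Nat.factorial_succ, ← linPhase]
      push_cast
      rw [Nat.sub_zero]
      field_simp
      ring
    simp only [e]
    refine IsSymbol.const_mul _ (IsSymbol.add ?_ (IsSymbol.sum _ fun i hi => ?_))
    · exact ((isSymbol_linPhase hγ t k).mul ih).mono (by push_cast; omega)
    · have := Finset.mem_range.mp hi
      exact ((isSymbol_coeff_phaseSeries hγ t k (i + 1)).mul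
        (isSymbol_schurP hγ t k (m - (i + 1)))).mono (by push_cast; omega)

theorem isSymbol_schurCoeff {γ : ℂ → ℂ} {k₀ : ℂ} (hγ : AnalyticAt ℂ γ k₀) (t : ℝ) (k n : ℕ)
    (U : PowerSeries ℂ) : IsSymbol k n (schurCoeff γ n k₀ t U) := by
  unfold schurCoeff
  simp only [PowerSeries.coeff_mul n, schurSeries, PowerSeries.coeff_mk]
  refine IsSymbol.sum _ fun ij hij => ((isSymbol_schurP hγ t k ij.2).const_mul _).mono ?_
  have := Finset.HasAntidiagonal.mem_antidiagonal.mp hij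
  omega

theorem isSymbol_schurCoeff_X_pow_mul {γ : ℂ → ℂ} {k₀ : ℂ} (hγ : AnalyticAt ℂ γ k₀) (t : ℝ)
    (k n j : ℕ) (U : PowerSeries ℂ) :
    IsSymbol k (n - j) (schurCoeff γ n k₀ t (PowerSeries.X ^ j * U)) := by
  rcases le_or_gt j n with h | h
  · rw [show schurCoeff γ n k₀ t (PowerSeries.X ^ j * U) = schurCoeff γ (n - j) k₀ t U from
      funext₂ fun x y => schurCoeff_X_pow_mul_of_le γ k₀ t U x y h]
    exact (isSymbol_schurCoeff hγ t k (n - j) U).mono (by omega)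
  · rw [show schurCoeff γ n k₀ t (PowerSeries.X ^ j * U) = fun _ _ => 0 from
      funext₂ fun x y => schurCoeff_X_pow_mul_of_lt γ k₀ t U x y h]
    exact isSymbol_zero k _

/-- Write `U = 1 + XV`: multiplication by `X` lowers the order by one, so only the constant term of
`U` is seen at top order. -/
theorem isSymbol_schurCoeff_sub {γ : ℂ → ℂ} {k₀ : ℂ} (hγ : AnalyticAt ℂ γ k₀) (t : ℝ) (k n : ℕ)
    {U : PowerSeries ℂ} (hU : PowerSeries.constantCoeff U = 1) :
    IsSymbol k (n - 1) (fun x y => schurCoeff γ n k₀ t U x y -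
      linPhase γ k₀ t x y ^ n / n.factorial) := by
  obtain ⟨V, hV⟩ : (PowerSeries.X : PowerSeries ℂ) ∣ U - 1 := by
    rw [PowerSeries.X_dvd_iff]; simp [hU]
  have e : ∀ x y, schurCoeff γ n k₀ t U x y - linPhase γ k₀ t x y ^ n / n.factorial =
      (schurP γ n k₀ x y t - linPhase γ k₀ t x y ^ n / n.factorial) +
        schurCoeff γ n k₀ t (PowerSeries.X ^ 1 * V) x y := by
    intro x y
    rw [show U = 1 + PowerSeries.X ^ 1 * V by rw [pow_one, ← hV]; ring, schurCoeff_add,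
      schurCoeff_one]
    ring
  simp only [e]
  exact (isSymbol_schurP_sub hγ t k n).add
    (by simpa using isSymbol_schurCoeff_X_pow_mul hγ t k n 1 V)

/-- Products inherit the comparison of the factors with their leading parts. -/
theorem IsSymbol.mul_sub_mul {k : ℕ} {m m' : ℤ} {f g f₀ g₀ : ℝ → ℝ → ℂ} (hf : IsSymbol k m f)
    (hg₀ : IsSymbol k m' g₀) (hff : IsSymbol k (m - 1) (fun x y => f x y - f₀ x y))
    (hgg : IsSymbol k (m' - 1) (fun x y => g x y - g₀ x y)) :
    IsSymbol k (m + m' - 1) (fun x y => f x y * g x y - f₀ x y * g₀ x y) := by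
  have e : ∀ x y, f x y * g x y - f₀ x y * g₀ x y =
      f x y * (g x y - g₀ x y) + (f x y - f₀ x y) * g₀ x y := fun x y => by ring
  simp only [e]
  exact ((hf.mul hgg).mono (by omega)).add ((hff.mul hg₀).mono (by omega))

theorem lumpF_eq_sum_mul_conj {γ : ℂ → ℂ} {k₀ : ℂ} (hγ : AnalyticAt ℂ γ k₀) (hk₀ : 0 < k₀.im)
    (n : ℕ) (t x y : ℝ) : (lumpF γ n k₀ x y t : ℂ) = ∑ m ∈ Finset.range (n + 1),
      schurCoeff γ n k₀ t (PowerSeries.X ^ m * ((PowerSeries.C (I / (2 * (k₀.im : ℂ))) *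
        resolventSeries k₀) ^ m * (1 + shiftSeries k₀ * resolventSeries k₀))) x y *
      star (schurCoeff γ n k₀ t (PowerSeries.X ^ m * ((PowerSeries.C (I / (2 * (k₀.im : ℂ))) *
        resolventSeries k₀) ^ m * (1 + shiftSeries k₀ * resolventSeries k₀))) x y) := by
  rw [lumpF_eq_cayleySum hγ hk₀, cayleySum, ofReal_sum]
  refine Finset.sum_congr rfl fun m _ => ?_
  rw [cayleyCoeff, cayleyCoeff, ← schurCoeff_add,
    show (shiftSeries k₀ * resolventSeries k₀) ^ m +
      (shiftSeries k₀ * resolventSeries k₀) ^ (m + 1) = PowerSeries.X ^ m *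
        ((PowerSeries.C (I / (2 * (k₀.im : ℂ))) * resolventSeries k₀) ^ m *
          (1 + shiftSeries k₀ * resolventSeries k₀)) by rw [shiftSeries]; ring]
  exact (Complex.conj_eq_iff_re.mp (by simp [mul_comm]))

theorem isSymbol_lumpF_sub {γ : ℂ → ℂ} {k₀ : ℂ} (hγ : AnalyticAt ℂ γ k₀) (hk₀ : 0 < k₀.im)
    (n : ℕ) (t : ℝ) (k : ℕ) :
    IsSymbol k (2 * n - 1) (fun x y => (lumpF γ n k₀ x y t : ℂ) -
      linPhase γ k₀ t x y ^ n / n.factorial *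
        star (linPhase γ k₀ t x y ^ n / n.factorial)) := by
  simp only [lumpF_eq_sum_mul_conj hγ hk₀]
  -- The square `m = 0` is split off: it alone has order `2n`, while a factor `X^{m+1}` in both
  -- entries costs at least two orders.
  simp only [Finset.sum_range_succ' _ n, add_sub_assoc]
  refine IsSymbol.add (IsSymbol.sum _ fun m hm => ?_) ?_
  · exact ((isSymbol_schurCoeff_X_pow_mul hγ t k n (m + 1) _).mul
      (isSymbol_schurCoeff_X_pow_mul hγ t k n (m + 1) _).star).mono (by push_cast; omega)
  · simp only [pow_zero, one_mul]
    have h1 := isSymbol_schurCoeff_sub hγ t k n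
      (U := 1 + shiftSeries k₀ * resolventSeries k₀) (by simp [shiftSeries])
    have h2 : IsSymbol k n (fun x y => linPhase γ k₀ t x y ^ n / n.factorial) := by
      simp only [div_eq_inv_mul]
      simpa using ((isSymbol_linPhase hγ t k).pow n).const_mul (n.factorial : ℂ)⁻¹
    have h3 := h1.star
    simp only [star_sub] at h3
    exact ((isSymbol_schurCoeff hγ t k n _).mul_sub_mul h2.star h1 h3).mono (by omega)

theorem isSymbol_lumpF {γ : ℂ → ℂ} {k₀ : ℂ} (hγ : AnalyticAt ℂ γ k₀) (hk₀ : 0 < k₀.im)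
    (n : ℕ) (t : ℝ) (k : ℕ) : IsSymbol k (2 * n) (fun x y => (lumpF γ n k₀ x y t : ℂ)) := by
  simp only [lumpF_eq_sum_mul_conj hγ hk₀]
  refine IsSymbol.sum _ fun m hm => ?_
  exact ((isSymbol_schurCoeff_X_pow_mul hγ t k n m _).mul
      (isSymbol_schurCoeff_X_pow_mul hγ t k n m _).star).mono (by omega)

/-- For `b ≠ 0` the map `(x, y) ↦ iθ'(k₀)` is an affine bijection of the plane onto `ℂ`: its real
part recovers `y`, and its imaginary part then recovers `x`. -/
theorem exists_weight_le_linPhase {γ : ℂ → ℂ} {k₀ : ℂ} (hγ : AnalyticAt ℂ γ k₀) (hk₀ : 0 < k₀.im)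
    (t : ℝ) : ∃ K : ℝ, 0 < K ∧ ∀ x y, weight x y ≤ K * (1 + ‖linPhase γ k₀ t x y‖) := by
  set d := linPhase γ k₀ t 0 0 with hd
  set L : ℝ := 1 + |k₀.re| / k₀.im + 1 / (2 * k₀.im) with hL
  have hL1 : 1 ≤ L := by
    have : 0 ≤ |k₀.re| / k₀.im + 1 / (2 * k₀.im) := by positivity
    rw [hL]
    linarith
  refine ⟨L * (1 + ‖d‖), by positivity, fun x y => ?_⟩
  set v := linPhase γ k₀ t x y - d with hv
  have hv' : v = I * x + 2 * I * k₀ * y := by rw [hv, linPhase_eq hγ t x y]; ring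
  have hre : v.re = -(2 * k₀.im * y) := by rw [hv']; simp
  have him : v.im = x + 2 * k₀.re * y := by rw [hv']; simp
  have hy : |y| ≤ ‖v‖ / (2 * k₀.im) := by
    rw [le_div_iff₀ (by positivity)]
    have := Complex.abs_re_le_norm v
    rw [hre, abs_neg, abs_mul, abs_of_pos (by positivity : 0 < 2 * k₀.im)] at this
    linarith
  have hx : |x| ≤ ‖v‖ + |k₀.re| / k₀.im * ‖v‖ := by
    have h1 := Complex.abs_im_le_norm v
    have h2 : x = v.im - 2 * k₀.re * y := by rw [him]; ring
    have h3 : |x| ≤ |v.im| + |2 * k₀.re * y| := by rw [h2]; exact abs_sub _ _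
    have h4 : |2 * k₀.re * y| ≤ |k₀.re| / k₀.im * ‖v‖ := by
      rw [abs_mul, abs_mul, abs_two]
      calc 2 * |k₀.re| * |y| ≤ 2 * |k₀.re| * (‖v‖ / (2 * k₀.im)) := by gcongr
        _ = _ := by field_simp
    linarith
  have hq : ‖((x, y) : ℝ × ℝ)‖ ≤ L * ‖v‖ := by
    rw [Prod.norm_def, Real.norm_eq_abs, Real.norm_eq_abs, hL, add_mul, add_mul, one_mul]
    have h0 : 0 ≤ ‖v‖ := norm_nonneg v
    have h1 : 0 ≤ |k₀.re| / k₀.im * ‖v‖ := by positivity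
    have h2 : 1 / (2 * k₀.im) * ‖v‖ = ‖v‖ / (2 * k₀.im) := by ring
    have h3 : 0 ≤ ‖v‖ / (2 * k₀.im) := by positivity
    rw [h2]
    exact max_le (by linarith) (by linarith)
  have hvn : ‖v‖ ≤ ‖linPhase γ k₀ t x y‖ + ‖d‖ := norm_sub_le _ _
  have h5 : (0 : ℝ) ≤ ‖linPhase γ k₀ t x y‖ * ‖d‖ := by positivity
  unfold weight
  calc 1 + ‖((x, y) : ℝ × ℝ)‖ ≤ L * 1 + L * ‖v‖ := by linarith
    _ ≤ L * 1 + L * (‖linPhase γ k₀ t x y‖ + ‖d‖) := by gcongr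
    _ ≤ L * (1 + ‖d‖) * (1 + ‖linPhase γ k₀ t x y‖) := by nlinarith

/-- The denominator `1 + |iθ'(k₀)|²`. -/
def bracket (γ : ℂ → ℂ) (k₀ : ℂ) (t x y : ℝ) : ℂ :=
  1 + linPhase γ k₀ t x y * star (linPhase γ k₀ t x y)

theorem bracket_eq (γ : ℂ → ℂ) (k₀ : ℂ) (t x y : ℝ) :
    bracket γ k₀ t x y = ((1 + ‖linPhase γ k₀ t x y‖ ^ 2 : ℝ) : ℂ) := by
  rw [bracket]
  simp [Complex.mul_conj, Complex.normSq_eq_norm_sq]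

theorem isSymbol_bracket {γ : ℂ → ℂ} {k₀ : ℂ} (hγ : AnalyticAt ℂ γ k₀) (t : ℝ) (k : ℕ) :
    IsSymbol k 2 (bracket γ k₀ t) :=
  ((isSymbol_const k 1).mono (by omega)).add
    ((isSymbol_linPhase hγ t k).mul (isSymbol_linPhase hγ t k).star)

theorem isSymbol_bracket_inv {γ : ℂ → ℂ} {k₀ : ℂ} (hγ : AnalyticAt ℂ γ k₀) (hk₀ : 0 < k₀.im) (t : ℝ)
    (k : ℕ) : IsSymbol k (-2) (fun x y => (bracket γ k₀ t x y)⁻¹) := by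
  obtain ⟨K, hK, h⟩ := exists_weight_le_linPhase hγ hk₀ t
  refine (isSymbol_bracket hγ t k).inv (c := (2 * K ^ 2)⁻¹) (by positivity) fun x y => ?_
  rw [bracket_eq, Complex.norm_real, Real.norm_of_nonneg (by positivity),
    inv_mul_le_iff₀ (by positivity)]
  have h1 := pow_le_pow_left₀ (weight_pos x y).le (h x y) 2
  have h2 : weight x y ^ (2 : ℤ) = weight x y ^ 2 := by norm_cast
  rw [h2]
  nlinarith [sq_nonneg (K * (1 - ‖linPhase γ k₀ t x y‖))]

/-- Ellipticity of `F_n`, which makes `1/F_n` a symbol. Far out the leading term dominates the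
error; on the remaining region the constant lower bound from the last square suffices. -/
theorem exists_le_lumpF {γ : ℂ → ℂ} {k₀ : ℂ} (hγ : AnalyticAt ℂ γ k₀) (hk₀ : 0 < k₀.im) (n : ℕ)
    (t : ℝ) : ∃ c : ℝ, 0 < c ∧ ∀ x y, c * weight x y ^ (2 * n : ℤ) ≤ lumpF γ n k₀ x y t := by
  obtain ⟨K, hK, h⟩ := exists_weight_le_linPhase hγ hk₀ t
  obtain ⟨-, C, hC⟩ := isSymbol_lumpF_sub hγ hk₀ n t 0
  set δ : ℝ := ((1 / (2 * k₀.im)) ^ n) ^ 2 with hδ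
  have hδpos : 0 < δ := by positivity
  set c₁ : ℝ := ((1 / (2 * K)) ^ n / n.factorial) ^ 2 with hc₁
  have hc₁pos : 0 < c₁ := by positivity
  -- Beyond weight `2K` the phase is at least `weight/(2K)`. Beyond weight `2|C|/c₁` the error is at
  -- most half of the leading term.
  set R : ℝ := max (2 * K) (2 * |C| / c₁) with hR
  have hRpos : 0 < R := lt_of_lt_of_le (by positivity) (le_max_left _ _)
  refine ⟨min (c₁ / 2) (δ / R ^ (2 * n)), by positivity, fun x y => ?_⟩
  have hw : weight x y ^ (2 * n : ℤ) = weight x y ^ (2 * n) := by norm_cast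
  have hwpos := weight_pos x y
  rw [hw]
  rcases le_total (weight x y) R with hwR | hwR
  · calc min (c₁ / 2) (δ / R ^ (2 * n)) * weight x y ^ (2 * n)
        ≤ δ / R ^ (2 * n) * R ^ (2 * n) := by gcongr; exact min_le_right _ _
      _ = δ := by field_simp
      _ ≤ _ := lumpF_ge hγ hk₀ n t x y
  · have h1 : 2 * K ≤ weight x y := (le_max_left _ _).trans hwR
    have h2 : 2 * |C| / c₁ ≤ weight x y := (le_max_right _ _).trans hwR
    have h3 : 1 / (2 * K) * weight x y ≤ ‖linPhase γ k₀ t x y‖ := by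
      have := h x y
      rw [div_mul_eq_mul_div, one_mul, div_le_iff₀ (by positivity)]
      nlinarith
    have h4 : c₁ * weight x y ^ (2 * n) ≤ (‖linPhase γ k₀ t x y‖ ^ n / n.factorial) ^ 2 := by
      have h5 : (1 / (2 * K) * weight x y) ^ n ≤ ‖linPhase γ k₀ t x y‖ ^ n :=
        pow_le_pow_left₀ (by positivity) h3 n
      calc c₁ * weight x y ^ (2 * n) = ((1 / (2 * K) * weight x y) ^ n / n.factorial) ^ 2 := by
            rw [hc₁, mul_pow, pow_mul']; ring
        _ ≤ _ := by gcongr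
    have h5 := hC x y
    beta_reduce at h5
    have h6 : linPhase γ k₀ t x y ^ n / n.factorial * star (linPhase γ k₀ t x y ^ n / n.factorial) =
        (((‖linPhase γ k₀ t x y‖ ^ n / n.factorial) ^ 2 : ℝ) : ℂ) := by
      change _ * (starRingEnd ℂ) _ = _
      rw [Complex.mul_conj, Complex.normSq_eq_norm_sq]
      simp
    rw [h6, ← ofReal_sub, Complex.norm_real, Real.norm_eq_abs] at h5
    have h7 : C * weight x y ^ (2 * n - 1 : ℤ) ≤ c₁ / 2 * weight x y ^ (2 * n) := by
      rw [zpow_sub_one₀ hwpos.ne', hw, ← div_eq_mul_inv, ← mul_div_assoc, div_le_iff₀ hwpos]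
      have h8 : |C| ≤ c₁ / 2 * weight x y := by
        rw [div_le_iff₀ hc₁pos] at h2; linarith
      calc C * weight x y ^ (2 * n) ≤ (c₁ / 2 * weight x y) * weight x y ^ (2 * n) := by
            gcongr; exact (le_abs_self C).trans h8
        _ = _ := by ring
    have h8 := (abs_le.mp h5).1
    calc min (c₁ / 2) (δ / R ^ (2 * n)) * weight x y ^ (2 * n) ≤ c₁ / 2 * weight x y ^ (2 * n) := by
          gcongr; exact min_le_left _ _
      _ ≤ _ := by linarith

theorem isSymbol_lumpF_inv {γ : ℂ → ℂ} {k₀ : ℂ} (hγ : AnalyticAt ℂ γ k₀) (hk₀ : 0 < k₀.im)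
    (n : ℕ) (t : ℝ) (k : ℕ) : IsSymbol k (-(2 * n)) (fun x y => (lumpF γ n k₀ x y t : ℂ)⁻¹) := by
  obtain ⟨c, hc, h⟩ := exists_le_lumpF hγ hk₀ n t
  refine (isSymbol_lumpF hγ hk₀ n t k).inv hc fun x y => ?_
  rw [Complex.norm_real, Real.norm_of_nonneg (lumpF_pos hγ hk₀ n t x y).le]
  exact h x y

/-! ### The integrals over the half-line and the Darboux transform -/

/-- The exponential `exp(iθ(k))`. -/
def wave (γ : ℂ → ℂ) (k : ℂ) (t x y : ℝ) : ℂ := exp (I * theta γ k x y t)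

theorem wave_ne_zero (γ : ℂ → ℂ) (k : ℂ) (t x y : ℝ) : wave γ k t x y ≠ 0 := exp_ne_zero _

theorem phi_eq (γ : ℂ → ℂ) (n : ℕ) (k : ℂ) (t x y : ℝ) :
    phi γ n k x y t = schurP γ n k x y t * wave γ k t x y := by
  rw [schurP, wave, mul_assoc, ← exp_add, neg_add_cancel, exp_zero, mul_one]

theorem wave_eq (γ : ℂ → ℂ) (k : ℂ) (t x y : ℝ) :
    wave γ k t x y = wave γ k t 0 y * exp (I * k * x) := by
  rw [wave, wave, ← exp_add]
  congr 1
  simp only [theta, ofReal_zero]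
  ring

theorem hasDerivAt_wave (γ : ℂ → ℂ) (k : ℂ) (t x y : ℝ) :
    HasDerivAt (fun s => wave γ k t s y) (I * k * wave γ k t x y) x := by
  rw [show (fun s => wave γ k t s y) = _ from funext fun s => wave_eq γ k t s y, wave_eq γ k t x y]
  have h : HasDerivAt (fun s : ℝ => I * k * (s : ℂ)) (I * k * (1 : ℝ)) x :=
    ((hasDerivAt_id x).ofReal_comp).const_mul (I * k)
  refine (h.cexp.const_mul _).congr_deriv ?_
  push_cast
  ring

theorem norm_wave (γ : ℂ → ℂ) (k : ℂ) (t x y : ℝ) :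
    ‖wave γ k t x y‖ = ‖wave γ k t 0 y‖ * Real.exp (-k.im * x) := by
  rw [wave_eq, norm_mul, Complex.norm_exp]
  congr 2
  simp

/-- The two exponentials decay together at rate `Im k + Im k₀ > 0`; half of that rate absorbs the
polynomial growth. -/
theorem isBigO_wave_mul (γ : ℂ → ℂ) {k k₀ : ℂ} (hk : -k₀.im < k.im) (t y : ℝ) {n : ℕ}
    {f : ℝ → ℝ → ℂ} (hf : IsSymbol 0 n f) :
    (fun s => wave γ k t s y * star (wave γ k₀ t s y) * f s y) =O[atTop]
      fun s : ℝ => Real.exp (-((k.im + k₀.im) / 2) * s) := by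
  obtain ⟨-, C, hC⟩ := hf
  set δ := k.im + k₀.im with hδ
  have hδ0 : 0 < δ := by rw [hδ]; linarith
  set c := ‖wave γ k t 0 y‖ * ‖wave γ k₀ t 0 y‖ with hc
  have h1 : (fun s => wave γ k t s y * star (wave γ k₀ t s y) * f s y) =O[atTop]
      fun s : ℝ => s ^ n * Real.exp (-δ * s) := by
    refine Asymptotics.IsBigO.of_bound (c * (|C| * (2 * (1 + |y|)) ^ n)) ?_
    filter_upwards [eventually_ge_atTop 1] with s hs
    have hw : weight s y ≤ 2 * (1 + |y|) * s := by
      have h2 : ‖((s, y) : ℝ × ℝ)‖ ≤ s + |y| := by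
        rw [Prod.norm_def, Real.norm_eq_abs, Real.norm_eq_abs, abs_of_nonneg (by linarith : 0 ≤ s)]
        exact max_le (by linarith [abs_nonneg y]) (by linarith)
      unfold weight
      nlinarith [abs_nonneg y]
    have hfs : ‖f s y‖ ≤ |C| * (2 * (1 + |y|)) ^ n * s ^ n := by
      calc ‖f s y‖ ≤ C * weight s y ^ (n : ℤ) := hC s y
        _ = C * weight s y ^ n := by rw [zpow_natCast]
        _ ≤ |C| * (2 * (1 + |y|) * s) ^ n := by
            have := (weight_pos s y).le
            gcongr
            exact le_abs_self C
        _ = _ := by rw [mul_pow]; ring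
    have e : Real.exp (-k.im * s) * Real.exp (-k₀.im * s) = Real.exp (-δ * s) := by
      rw [← Real.exp_add]; congr 1; rw [hδ]; ring
    rw [norm_mul, norm_mul, norm_star, norm_wave, norm_wave γ k₀]
    calc _ = c * Real.exp (-δ * s) * ‖f s y‖ := by rw [← e, hc]; ring
      _ ≤ c * Real.exp (-δ * s) * (|C| * (2 * (1 + |y|)) ^ n * s ^ n) := by gcongr
      _ = c * (|C| * (2 * (1 + |y|)) ^ n) * (s ^ n * Real.exp (-δ * s)) := by ring
      _ ≤ _ := by gcongr; exact Real.le_norm_self _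
  refine h1.trans ?_
  have h2 := (isLittleO_pow_exp_pos_mul_atTop n (half_pos hδ0)).isBigO.mul
    (Asymptotics.isBigO_refl (fun s : ℝ => Real.exp (-δ * s)) atTop)
  refine h2.congr_right fun s => ?_
  rw [← Real.exp_add]
  congr 1
  ring

theorem tendsto_wave_mul (γ : ℂ → ℂ) {k k₀ : ℂ} (hk : -k₀.im < k.im) (t y : ℝ) {n : ℕ}
    {f : ℝ → ℝ → ℂ} (hf : IsSymbol 0 n f) :
    Tendsto (fun s => wave γ k t s y * star (wave γ k₀ t s y) * f s y) atTop (𝓝 0) := by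
  refine (isBigO_wave_mul γ hk t y hf).trans_tendsto ?_
  refine Real.tendsto_exp_atBot.comp ?_
  exact tendsto_id.const_mul_atTop_of_neg (by linarith)

theorem integrableOn_wave_mul (γ : ℂ → ℂ) {k k₀ : ℂ} (hk : -k₀.im < k.im) (t x y : ℝ) {n : ℕ}
    {f : ℝ → ℝ → ℂ} (hf : IsSymbol 0 n f) :
    IntegrableOn (fun s => wave γ k t s y * star (wave γ k₀ t s y) * f s y) (Set.Ioi x) := by
  have hw : ∀ k, Continuous (fun s => wave γ k t s y) := fun k =>
    continuous_iff_continuousAt.mpr fun s => (hasDerivAt_wave γ k t s y).continuousAt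
  have hc : Continuous (fun s => wave γ k t s y * star (wave γ k₀ t s y) * f s y) :=
    ((hw k).mul (hw k₀).star).mul (hf.1.comp (Continuous.prodMk continuous_id continuous_const))
  rw [IntegrableOn, ← integrable_norm_iff hc.aestronglyMeasurable]
  exact integrable_of_isBigO_exp_neg (by linarith) hc.norm.continuousOn
    (isBigO_wave_mul γ hk t y hf).norm_left

/-- The geometric series `∑ c^{i+1} X^i`. -/
def geomSeries (c : ℂ) : PowerSeries ℂ := PowerSeries.mk fun i => c ^ (i + 1)

theorem C_mul_X_mul_geomSeries (c : ℂ) :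
    PowerSeries.C c * (PowerSeries.X * geomSeries c) = geomSeries c - PowerSeries.C c := by
  ext i
  rcases i with _ | i <;> simp [geomSeries, pow_succ']

theorem schurCoeff_geomSeries (γ : ℂ → ℂ) (n : ℕ) (k₀ : ℂ) (t : ℝ) (c : ℂ) (x y : ℝ) :
    schurCoeff γ n k₀ t (geomSeries c) x y = c * (schurP γ n k₀ x y t +
      ∑ j ∈ Finset.Icc 1 n, schurP γ (n - j) k₀ x y t * c ^ j) := by
  rw [schurCoeff, PowerSeries.coeff_mul, Finset.Nat.sum_antidiagonal_eq_sum_range_succ_mk,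
    Finset.sum_range_succ', add_comm, mul_add]
  simp only [geomSeries, schurSeries, PowerSeries.coeff_mk]
  congr 1
  · simp
  · rw [Finset.mul_sum, Finset.range_eq_Ico, Finset.sum_Ico_add' (fun j =>
      c ^ (j + 1) * schurP γ (n - j) k₀ x y t) 0 n 1]
    refine Finset.sum_congr (by ext; simp) fun j _ => by ring

/-- Repeated integration by parts, summed at once. The product of exponentials has logarithmic
derivative `i(k - k̄₀)`, so the antiderivative is a geometric series in `(k - k̄₀)⁻¹` applied to
`p̄_n`, which stops after `n + 1` terms. It vanishes at `+∞` since `Im k > -b`. -/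
theorem integral_wave_mul_conj_phi {γ : ℂ → ℂ} {k₀ : ℂ} (hγ : AnalyticAt ℂ γ k₀) (n : ℕ)
    (t x y : ℝ) {k : ℂ} (hk : -k₀.im < k.im) :
    ∫ s in Set.Ioi x, wave γ k t s y * star (phi γ n k₀ s y t) =
      I * (wave γ k t x y * star (wave γ k₀ t x y) *
        star (schurCoeff γ n k₀ t (geomSeries (star (k - star k₀))⁻¹) x y)) := by
  have hne : star (k - star k₀) ≠ 0 := by
    rw [Ne, star_eq_zero, sub_eq_zero]
    rintro rfl
    simp at hk
  set c := (star (k - star k₀))⁻¹ with hc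
  have hderiv : ∀ s, HasDerivAt (fun s => -I * (wave γ k t s y * star (wave γ k₀ t s y) *
      star (schurCoeff γ n k₀ t (geomSeries c) s y)))
      (wave γ k t s y * star (wave γ k₀ t s y) * star (schurP γ n k₀ s y t)) s := by
    intro s
    have h1 : schurCoeff γ n k₀ t (PowerSeries.C I * PowerSeries.X * geomSeries c) s y =
        I * (star (k - star k₀) * schurCoeff γ n k₀ t (geomSeries c) s y - schurP γ n k₀ s y t) := by
      have h2 : c * schurCoeff γ n k₀ t (PowerSeries.X * geomSeries c) s y =
          schurCoeff γ n k₀ t (geomSeries c) s y - c * schurP γ n k₀ s y t := by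
        rw [← schurCoeff_C_mul, C_mul_X_mul_geomSeries, sub_eq_add_neg, ← map_neg, ← mul_one
          (PowerSeries.C (-c)), schurCoeff_add, schurCoeff_C_mul, schurCoeff_one]
        ring
      rw [mul_assoc, schurCoeff_C_mul]
      congr 1
      apply mul_left_cancel₀ (inv_ne_zero hne)
      rw [← hc, h2, mul_sub, ← mul_assoc, hc, inv_mul_cancel₀ hne, one_mul]
    have h3 := hasDerivAt_schurCoeff_fst hγ n t (geomSeries c) s y
    rw [h1] at h3
    refine ((((hasDerivAt_wave γ k t s y).mul (hasDerivAt_wave γ k₀ t s y).star).mul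
      h3.star).const_mul (-I)).congr_deriv ?_
    have hI : star I = -I := Complex.conj_I
    simp only [star_mul', star_sub, star_star, hI, Pi.mul_apply]
    linear_combination (-(wave γ k t s y * star (wave γ k₀ t s y) *
      star (schurP γ n k₀ s y t))) * I_sq
  have hint := integrableOn_wave_mul γ hk t x y (isSymbol_schurP hγ t 0 n).star
  have hlim := (tendsto_wave_mul γ hk t y
    (isSymbol_schurCoeff hγ t 0 n (geomSeries c)).star).const_mul (-I)
  rw [mul_zero] at hlim
  have h := integral_Ioi_of_hasDerivAt_of_tendsto' (a := x) (fun s _ => hderiv s) hint hlim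
  have e : ∀ s, wave γ k t s y * star (phi γ n k₀ s y t) =
      wave γ k t s y * star (wave γ k₀ t s y) * star (schurP γ n k₀ s y t) := by
    intro s; rw [phi_eq, star_mul']; ring
  simp only [e, h]
  ring

theorem hasDerivAt_normSq_wave_mul_lumpF {γ : ℂ → ℂ} {k₀ : ℂ} (hγ : AnalyticAt ℂ γ k₀)
    (hk₀ : 0 < k₀.im) (n : ℕ) (t x y : ℝ) :
    HasDerivAt (fun s => ‖wave γ k₀ t s y‖ ^ 2 * lumpF γ n k₀ s y t / (2 * k₀.im))
      (-‖phi γ n k₀ x y t‖ ^ 2) x := by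
  have hw : HasDerivAt (fun s => ‖wave γ k₀ t s y‖ ^ 2)
      (-(2 * k₀.im) * ‖wave γ k₀ t x y‖ ^ 2) x := by
    have e : ∀ z : ℂ, (z * star z).re = ‖z‖ ^ 2 := by
      intro z; rw [Complex.sq_norm, Complex.normSq_apply]; simp
    have h := hasDerivAt_re_mul_conj (hasDerivAt_wave γ k₀ t x y) (hasDerivAt_wave γ k₀ t x y)
    simp only [e] at h
    refine h.congr_deriv ?_
    rw [← e]
    simp
    ring
  refine ((hw.mul (hasDerivAt_lumpF_fst hγ hk₀ n t x y)).div_const _).congr_deriv ?_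
  rw [phi_eq, norm_mul]
  field_simp
  ring

/-- Since `F_x = 2b(F - |p_n|²)` and `|E|²` decays like `e^{-2bx}`, the function `|E|²F/2b` has
derivative `-|φ_n|²` and limit zero at `+∞`. -/
theorem tau_eq {γ : ℂ → ℂ} {k₀ : ℂ} (hγ : AnalyticAt ℂ γ k₀) (hk₀ : 0 < k₀.im) (n : ℕ)
    (t x y : ℝ) :
    tau γ n k₀ x y t = ‖wave γ k₀ t x y‖ ^ 2 * lumpF γ n k₀ x y t / (2 * k₀.im) := by
  have hlim : Tendsto (fun s => ‖wave γ k₀ t s y‖ ^ 2 * lumpF γ n k₀ s y t / (2 * k₀.im)) atTop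
      (𝓝 0) := by
    have h := (tendsto_wave_mul γ (by linarith : -k₀.im < k₀.im) t y
      (n := 2 * n) (by exact_mod_cast isSymbol_lumpF hγ hk₀ n t 0)).norm.div_const (2 * k₀.im)
    rw [norm_zero, zero_div] at h
    refine h.congr fun s => ?_
    rw [norm_mul, norm_mul, norm_star, Complex.norm_real,
      Real.norm_of_nonneg (lumpF_pos hγ hk₀ n t s y).le, pow_two]
  have h := integral_Ioi_of_hasDerivAt_of_nonneg' (a := x) (g := fun s =>
    -(‖wave γ k₀ t s y‖ ^ 2 * lumpF γ n k₀ s y t / (2 * k₀.im)))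
    (g' := fun s => ‖phi γ n k₀ s y t‖ ^ 2) (fun s _ =>
      (hasDerivAt_normSq_wave_mul_lumpF hγ hk₀ n t s y).fun_neg.congr_deriv (neg_neg _))
    (fun s _ => by positivity) hlim.neg
  rw [tau, h]
  ring

theorem bilinM_phi_conj_phi {γ : ℂ → ℂ} {k₀ : ℂ} (hγ : AnalyticAt ℂ γ k₀) (hk₀ : 0 < k₀.im)
    (n : ℕ) (t x y : ℝ) :
    bilinM (fun x' => phi γ n k₀ x' y t) (fun x' => star (phi γ n k₀ x' y t)) x =
      wave γ k₀ t x y * star (wave γ k₀ t x y) * lumpF γ n k₀ x y t / (2 * k₀.im) := by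
  have e : ∀ z : ℂ, z * star z = ((‖z‖ ^ 2 : ℝ) : ℂ) := by
    intro z
    change z * (starRingEnd ℂ) z = _
    rw [Complex.mul_conj, Complex.normSq_eq_norm_sq]
  rw [bilinM]
  simp only [e]
  rw [show ∫ x' in Set.Ioi x, ((‖phi γ n k₀ x' y t‖ ^ 2 : ℝ) : ℂ) = (tau γ n k₀ x y t : ℂ) from
    integral_ofReal, tau_eq hγ hk₀]
  push_cast
  ring

theorem sub_star_eq (k₀ : ℂ) : k₀ - star k₀ = 2 * I * k₀.im := by
  apply Complex.ext <;> simp; ring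

theorem darbouxPsi_eq {γ : ℂ → ℂ} {k₀ : ℂ} (hγ : AnalyticAt ℂ γ k₀) (hk₀ : 0 < k₀.im)
    (n : ℕ) (t x y : ℝ) {k : ℂ} (hk : -k₀.im < k.im) (hkk : k ≠ k₀) :
    darbouxPsi γ n k₀ x y t k = mu γ n k₀ x y t k * exp (I * theta γ k x y t) := by
  have hb : (k₀.im : ℂ) ≠ 0 := by exact_mod_cast hk₀.ne'
  have hne : k - star k₀ ≠ 0 := by
    rw [sub_ne_zero]
    rintro rfl
    simp at hk
  have hkk' : k - k₀ ≠ 0 := sub_ne_zero.mpr hkk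
  have hF : (lumpF γ n k₀ x y t : ℂ) ≠ 0 := by exact_mod_cast (lumpF_pos hγ hk₀ n t x y).ne'
  have hE := wave_ne_zero γ k₀ t x y
  have hE' : star (wave γ k₀ t x y) ≠ 0 := star_ne_zero.mpr hE
  have h1 : bilinM (fun x' => seed γ k₀ k x' y t) (fun x' => star (phi γ n k₀ x' y t)) x =
      (k - star k₀) / (k - k₀) * ∫ s in Set.Ioi x, wave γ k t s y * star (phi γ n k₀ s y t) := by
    rw [bilinM, ← integral_const_mul]
    simp only [seed, wave, mul_assoc]
  have h2 : ∑ j ∈ Finset.Icc 1 n, star (schurP γ (n - j) k₀ x y t) / (k - star k₀) ^ j =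
      star (∑ j ∈ Finset.Icc 1 n, schurP γ (n - j) k₀ x y t * (star (k - star k₀))⁻¹ ^ j) := by
    rw [star_sum]
    refine Finset.sum_congr rfl fun j _ => ?_
    rw [star_mul', star_pow, star_inv₀, star_star, inv_pow, div_eq_mul_inv]
  rw [darbouxPsi, h1, integral_wave_mul_conj_phi hγ n t x y hk, bilinM_phi_conj_phi hγ hk₀,
    schurCoeff_geomSeries, mu]
  dsimp only
  rw [h2, sub_star_eq k₀, seed, phi_eq, ← wave, star_mul' _ (_ + _), star_inv₀, star_star, star_add]
  generalize star (∑ j ∈ Finset.Icc 1 n, schurP γ (n - j) k₀ x y t * (star (k - star k₀))⁻¹ ^ j) = S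
  have h3 : k - star k₀ = (k - k₀) + 2 * I * k₀.im := by rw [← sub_star_eq]; ring
  rw [h3] at hne ⊢
  field_simp
  ring

/-- From the formula for `τ_n` one gets `∂_x log τ_n = -2b |p_n|²/F_n`; this is differentiated once
more. -/
theorem lumpU_eq {γ : ℂ → ℂ} {k₀ : ℂ} (hγ : AnalyticAt ℂ γ k₀) (hk₀ : 0 < k₀.im)
    (n : ℕ) (t x y : ℝ) :
    (lumpU γ n k₀ x y t : ℂ) = -(4 * k₀.im) *
      ((I * schurCoeff γ n k₀ t PowerSeries.X x y * star (schurP γ n k₀ x y t) -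
        I * schurP γ n k₀ x y t * star (schurCoeff γ n k₀ t PowerSeries.X x y)) *
          lumpF γ n k₀ x y t -
        schurP γ n k₀ x y t * star (schurP γ n k₀ x y t) * (2 * k₀.im *
          (lumpF γ n k₀ x y t - schurP γ n k₀ x y t * star (schurP γ n k₀ x y t)))) /
        lumpF γ n k₀ x y t ^ 2 := by
  have e : ∀ z : ℂ, (z * star z).re = ‖z‖ ^ 2 := by
    intro z; rw [Complex.sq_norm, Complex.normSq_apply]; simp
  have hE : ∀ s, 0 < ‖wave γ k₀ t s y‖ ^ 2 := fun s =>
    pow_pos (norm_pos_iff.mpr (wave_ne_zero γ k₀ t s y)) 2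
  have hd : deriv (fun x' : ℝ => Real.log (tau γ n k₀ x' y t)) = fun x' =>
      -(2 * k₀.im) * (‖schurP γ n k₀ x' y t‖ ^ 2 / lumpF γ n k₀ x' y t) := by
    ext s
    simp only [tau_eq hγ hk₀]
    have hF := lumpF_pos hγ hk₀ n t s y
    have hs := hE s
    have hs' : 0 < ‖wave γ k₀ t s y‖ := norm_pos_iff.mpr (wave_ne_zero γ k₀ t s y)
    rw [((hasDerivAt_normSq_wave_mul_lumpF hγ hk₀ n t s y).log (by positivity)).deriv, phi_eq,
      norm_mul]
    field_simp
  have hp : HasDerivAt (fun s => ‖schurP γ n k₀ s y t‖ ^ 2)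
      (I * schurCoeff γ n k₀ t PowerSeries.X x y * star (schurP γ n k₀ x y t) -
        I * schurP γ n k₀ x y t * star (schurCoeff γ n k₀ t PowerSeries.X x y)).re x := by
    have h := hasDerivAt_schurCoeff_fst hγ n t 1 x y
    simp only [schurCoeff_one, mul_one, schurCoeff_C_mul] at h
    have h' := hasDerivAt_re_mul_conj h h
    simp only [e] at h'
    refine h'.congr_deriv ?_
    simp
    ring
  have hF := lumpF_pos hγ hk₀ n t x y
  rw [lumpU, iteratedDeriv_succ', iteratedDeriv_one, hd,
    ((hp.fun_div (hasDerivAt_lumpF_fst hγ hk₀ n t x y) hF.ne').const_mul _).deriv]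
  have h1 : ((I * schurCoeff γ n k₀ t PowerSeries.X x y * star (schurP γ n k₀ x y t) -
        I * schurP γ n k₀ x y t * star (schurCoeff γ n k₀ t PowerSeries.X x y)).re : ℂ) =
      I * schurCoeff γ n k₀ t PowerSeries.X x y * star (schurP γ n k₀ x y t) -
        I * schurP γ n k₀ x y t * star (schurCoeff γ n k₀ t PowerSeries.X x y) := by
    apply Complex.conj_eq_iff_re.mp
    simp
    ring
  have h2 : ((‖schurP γ n k₀ x y t‖ ^ 2 : ℝ) : ℂ) =
      schurP γ n k₀ x y t * star (schurP γ n k₀ x y t) := by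
    rw [← e]
    apply Complex.conj_eq_iff_re.mp
    simp [mul_comm]
  generalize (I * schurCoeff γ n k₀ t PowerSeries.X x y * star (schurP γ n k₀ x y t) -
        I * schurP γ n k₀ x y t * star (schurCoeff γ n k₀ t PowerSeries.X x y)).re = w at h1 ⊢
  rw [← h2, ← h1]
  push_cast
  ring

/-! ### Laurent coefficients and partial fractions of `μ` -/

/-- On every small circle the holomorphic part integrates to zero, and among the powers only
exponent `-1`, that is `j = J`, survives. The Cauchy integral is thus eventually constant in the
radius, so its limit is immediate. -/
theorem laurentCoeff_eq {f h : ℂ → ℂ} {a : ℕ → ℂ} {c : ℂ} {R : ℝ} {n : ℕ} (hR : 0 < R)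
    (hh : DifferentiableOn ℂ h (Metric.ball c R))
    (hf : ∀ z ∈ Metric.ball c R, z ≠ c →
      f z = h z + ∑ j ∈ Finset.Icc 1 n, a j / (z - c) ^ j)
    {J : ℕ} (hJ1 : 1 ≤ J) (hJn : J ≤ n) : laurentCoeff f c (-(J : ℤ)) = a J := by
  refine Tendsto.limUnder_eq (tendsto_const_nhds.congr' ?_)
  filter_upwards [Ioo_mem_nhdsGT hR] with r hr
  obtain ⟨hr0, hrR⟩ := hr
  have hne : ∀ z ∈ Metric.sphere c r, z - c ≠ 0 := fun z hz h0 => by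
    rw [mem_sphere_iff_norm, h0, norm_zero] at hz
    exact hr0.ne hz
  have hcl : Metric.closedBall c r ⊆ Metric.ball c R := Metric.closedBall_subset_ball hrR
  have hg : DifferentiableOn ℂ (fun z => (z - c) ^ (J - 1) * h z) (Metric.closedBall c r) :=
    DifferentiableOn.mul (by fun_prop) (hh.mono hcl)
  have hcongr : Set.EqOn (fun z => (z - c) ^ (-(-(J : ℤ)) - 1) * f z)
      (fun z => (z - c) ^ (J - 1) * h z +
        ∑ j ∈ Finset.Icc 1 n, a j * (z - c) ^ ((J : ℤ) - 1 - j)) (Metric.sphere c r) := by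
    intro z hz
    have hz0 := hne z hz
    beta_reduce
    rw [hf z (hcl (Metric.sphere_subset_closedBall hz)) (sub_ne_zero.mp hz0), mul_add,
      Finset.mul_sum, neg_neg, show (J : ℤ) - 1 = ((J - 1 : ℕ) : ℤ) by omega, zpow_natCast]
    congr 1
    refine Finset.sum_congr rfl fun j _ => ?_
    rw [zpow_sub₀ hz0, zpow_natCast, zpow_natCast]
    ring
  have hci : ∀ j ∈ Finset.Icc 1 n,
      CircleIntegrable (fun z => a j * (z - c) ^ ((J : ℤ) - 1 - j)) c r := fun j _ => by
    refine ContinuousOn.circleIntegrable hr0.le (continuousOn_const.mul ?_)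
    exact ContinuousOn.zpow₀ (by fun_prop) _ fun z hz => Or.inl (hne z hz)
  rw [circleIntegral.integral_congr hr0.le hcongr, circleIntegral.integral_add
    ((hg.continuousOn.mono Metric.sphere_subset_closedBall).circleIntegrable hr0.le)
    (CircleIntegrable.fun_sum _ hci), circleIntegral.integral_fun_sum hci,
    (hg.mono Metric.closure_ball_subset_closedBall).diffContOnCl.circleIntegral_eq_zero hr0.le,
    zero_add, Finset.sum_eq_single J]
  · rw [circleIntegral.integral_const_mul, show (J : ℤ) - 1 - J = -1 by omega]
    simp only [zpow_neg_one]
    rw [circleIntegral.integral_sub_center_inv c hr0.ne']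
    have := Complex.two_pi_I_ne_zero
    field_simp
  · intro j _ hj
    rw [circleIntegral.integral_const_mul,
      circleIntegral.integral_sub_zpow_of_ne (by omega), mul_zero]
  · intro h
    exact absurd (Finset.mem_Icc.mpr ⟨hJ1, hJn⟩) h

/-- Partial fraction decomposition with numerators in telescoping form. -/
theorem mul_sum_div_pow_eq {s β : ℂ} (hs : s ≠ 0) (hβ : β ≠ 0) (hsβ : s - β ≠ 0) (g : ℕ → ℂ)
    (m : ℕ) : β / (s - β) * ∑ j ∈ Finset.Icc 1 m, (g j - g (j + 1) / β) / s ^ j =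
      g 1 / (s - β) - ∑ j ∈ Finset.Icc 1 m, g j / s ^ j - g (m + 1) / s ^ m / (s - β) := by
  induction m with
  | zero => simp
  | succ m ih =>
    rw [Finset.sum_Icc_succ_top (by omega), Finset.sum_Icc_succ_top (by omega), mul_add, ih]
    field_simp
    ring

/-- The function `conj ((1 - ∂_x/2b)^{-1} p_{n-j})`, the numerator at the pole `conj k₀`. -/
def conjResolvent (γ : ℂ → ℂ) (n : ℕ) (k₀ : ℂ) (t : ℝ) (j : ℕ) (x y : ℝ) : ℂ :=
  star (schurCoeff γ n k₀ t (PowerSeries.X ^ j * resolventSeries k₀) x y)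

theorem conjResolvent_of_lt (γ : ℂ → ℂ) {n : ℕ} (k₀ : ℂ) (t : ℝ) {j : ℕ} (h : n < j) (x y : ℝ) :
    conjResolvent γ n k₀ t j x y = 0 := by
  rw [conjResolvent, schurCoeff_X_pow_mul_of_lt _ _ _ _ _ _ h, star_zero]

/-- The conjugate of `(1 - S)R = 1` applied to `p_{n-j}`; the scalar `i/2b` in `S` conjugates to
`1/(k₀ - k̄₀)`. This is the telescoping form of the numerators required by `mul_sum_div_pow_eq`. -/
theorem star_schurP_sub (γ : ℂ → ℂ) {n : ℕ} {k₀ : ℂ} (hk₀ : 0 < k₀.im) (t : ℝ) {j : ℕ}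
    (h : j ≤ n) (x y : ℝ) :
    star (schurP γ (n - j) k₀ x y t) = conjResolvent γ n k₀ t j x y -
      conjResolvent γ n k₀ t (j + 1) x y / (k₀ - star k₀) := by
  have hb : (k₀.im : ℂ) ≠ 0 := by exact_mod_cast hk₀.ne'
  have h1 : schurP γ (n - j) k₀ x y t =
      schurCoeff γ n k₀ t (PowerSeries.X ^ j * resolventSeries k₀) x y -
        I / (2 * k₀.im) *
          schurCoeff γ n k₀ t (PowerSeries.X ^ (j + 1) * resolventSeries k₀) x y := by
    rw [← schurCoeff_one, ← schurCoeff_X_pow_mul_of_le γ k₀ t 1 x y h, ← schurCoeff_C_mul,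
      eq_sub_iff_add_eq, ← schurCoeff_add]
    congr 1
    have h2 := one_sub_shift_mul_resolvent k₀
    rw [shiftSeries] at h2
    linear_combination (-PowerSeries.X ^ j) * h2
  have hI : star (I / (2 * (k₀.im : ℂ))) = (k₀ - star k₀)⁻¹ := by
    rw [sub_star_eq]
    simp
    field_simp
  rw [h1, star_sub, star_mul', hI, conjResolvent, conjResolvent]
  ring

/-- The residue of `μ` at `k₀`. -/
def residueUp (γ : ℂ → ℂ) (n : ℕ) (k₀ : ℂ) (t x y : ℝ) : ℂ :=
  (k₀ - star k₀) * (1 - schurP γ n k₀ x y t * star (schurP γ n k₀ x y t) / lumpF γ n k₀ x y t) -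
    schurP γ n k₀ x y t / lumpF γ n k₀ x y t * conjResolvent γ n k₀ t 1 x y

/-- The partial fraction decomposition of `μ`. -/
theorem mu_eq {γ : ℂ → ℂ} {k₀ : ℂ} (hγ : AnalyticAt ℂ γ k₀) (hk₀ : 0 < k₀.im)
    (n : ℕ) (t x y : ℝ) {k : ℂ} (h1 : k ≠ k₀) (h2 : k ≠ star k₀) :
    mu γ n k₀ x y t k = 1 + residueUp γ n k₀ t x y / (k - k₀) +
      ∑ j ∈ Finset.Icc 1 n, schurP γ n k₀ x y t / lumpF γ n k₀ x y t *
        conjResolvent γ n k₀ t j x y / (k - star k₀) ^ j := by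
  have hF : (lumpF γ n k₀ x y t : ℂ) ≠ 0 := by exact_mod_cast (lumpF_pos hγ hk₀ n t x y).ne'
  have hb : (k₀.im : ℂ) ≠ 0 := by exact_mod_cast hk₀.ne'
  have hβ : k₀ - star k₀ ≠ 0 := by
    rw [sub_star_eq]; exact mul_ne_zero (mul_ne_zero two_ne_zero I_ne_zero) hb
  have hs : k - star k₀ ≠ 0 := sub_ne_zero.mpr h2
  have hk : k - k₀ ≠ 0 := sub_ne_zero.mpr h1
  have hk' : k - star k₀ - (k₀ - star k₀) = k - k₀ := by ring
  -- The boundary term of the decomposition contains the numerator of index `n + 1`, which is zero.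
  have h := mul_sum_div_pow_eq hs hβ (by rwa [hk'])
    (fun j => conjResolvent γ n k₀ t j x y) n
  beta_reduce at h
  rw [conjResolvent_of_lt γ k₀ t (Nat.lt_succ_self n), hk', zero_div, zero_div, sub_zero] at h
  have e : ∑ j ∈ Finset.Icc 1 n, star (schurP γ (n - j) k₀ x y t) / (k - star k₀) ^ j =
      ∑ j ∈ Finset.Icc 1 n, (conjResolvent γ n k₀ t j x y -
      conjResolvent γ n k₀ t (j + 1) x y / (k₀ - star k₀)) / (k - star k₀) ^ j :=
    Finset.sum_congr rfl fun j hj => by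
      rw [star_schurP_sub γ hk₀ t (Finset.mem_Icc.mp hj).2]
  simp only [mul_div_assoc, ← Finset.mul_sum]
  rw [mu]
  dsimp only
  rw [e, mul_sub, mul_left_comm, h, residueUp]
  field_simp
  ring

theorem star_ne_self {k₀ : ℂ} (hk₀ : 0 < k₀.im) : star k₀ ≠ k₀ := by
  intro h
  have := congrArg Complex.im h
  simp at this
  linarith

theorem residue_mu_self {γ : ℂ → ℂ} {k₀ : ℂ} (hγ : AnalyticAt ℂ γ k₀) (hk₀ : 0 < k₀.im)
    (n : ℕ) (t x y : ℝ) : residue (mu γ n k₀ x y t) k₀ = residueUp γ n k₀ t x y := by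
  have hd : 0 < dist k₀ (star k₀) := dist_pos.mpr (star_ne_self hk₀).symm
  have hne : ∀ z ∈ Metric.ball k₀ (dist k₀ (star k₀)), z ≠ star k₀ := by
    rintro z hz rfl
    rw [Metric.mem_ball, dist_comm] at hz
    exact lt_irrefl _ hz
  have h := laurentCoeff_eq (f := mu γ n k₀ x y t) (a := fun _ => residueUp γ n k₀ t x y) (c := k₀)
    (n := 1)
    (h := fun k => 1 + ∑ j ∈ Finset.Icc 1 n, schurP γ n k₀ x y t / lumpF γ n k₀ x y t *
        conjResolvent γ n k₀ t j x y / (k - star k₀) ^ j) hd ?_ ?_ le_rfl le_rfl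
  · simpa [residue] using h
  · refine DifferentiableOn.const_add _ (DifferentiableOn.fun_sum fun j _ => ?_)
    exact DifferentiableOn.div (by fun_prop) (by fun_prop) fun z hz =>
      pow_ne_zero _ (sub_ne_zero.mpr (hne z hz))
  · intro z hz hzk
    rw [mu_eq hγ hk₀ n t x y hzk (hne z hz)]
    simp
    ring

theorem laurentCoeff_mu_star {γ : ℂ → ℂ} {k₀ : ℂ} (hγ : AnalyticAt ℂ γ k₀) (hk₀ : 0 < k₀.im)
    {n : ℕ} (t x y : ℝ) {j : ℕ} (hj1 : 1 ≤ j) (hjn : j ≤ n) :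
    laurentCoeff (mu γ n k₀ x y t) (star k₀) (-(j : ℤ)) =
      schurP γ n k₀ x y t / lumpF γ n k₀ x y t * conjResolvent γ n k₀ t j x y := by
  have hd : 0 < dist (star k₀) k₀ := dist_pos.mpr (star_ne_self hk₀)
  have hne : ∀ z ∈ Metric.ball (star k₀) (dist (star k₀) k₀), z ≠ k₀ := by
    rintro z hz rfl
    rw [Metric.mem_ball, dist_comm] at hz
    exact lt_irrefl _ hz
  refine laurentCoeff_eq (f := mu γ n k₀ x y t) (a := fun j => schurP γ n k₀ x y t /
    lumpF γ n k₀ x y t * conjResolvent γ n k₀ t j x y)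
    (h := fun k => 1 + residueUp γ n k₀ t x y / (k - k₀)) hd ?_ ?_ hj1 hjn
  · refine DifferentiableOn.const_add _ ?_
    exact DifferentiableOn.div (by fun_prop) (by fun_prop) fun z hz =>
      sub_ne_zero.mpr (hne z hz)
  · intro z hz hzk
    rw [mu_eq hγ hk₀ n t x y (hne z hz) hzk]

/-! ### Integration of derivatives over the plane, and the model integral -/

theorem IsOfOrder.integrable {f : ℝ → ℝ → ℂ} (hf : IsOfOrder (-3) f) :
    Integrable (fun q : ℝ × ℝ => f q.1 q.2) := by
  obtain ⟨hc, C, hC⟩ := hf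
  have h := (integrable_one_add_norm (E := ℝ × ℝ) (μ := volume) (r := 3) (by simp; norm_num))
  refine (h.const_mul C).mono' hc.aestronglyMeasurable (ae_of_all _ fun q => ?_)
  refine (hC q.1 q.2).trans (le_of_eq ?_)
  rw [weight, show (-3 : ℝ) = ((-3 : ℤ) : ℝ) by norm_num, Real.rpow_intCast]

theorem tendsto_weight_fst (y : ℝ) {l : Filter ℝ} (hl : Tendsto (fun s : ℝ => |s|) l atTop) :
    Tendsto (fun s => weight s y) l atTop := by
  refine tendsto_atTop_mono (fun s => ?_) hl
  have := norm_fst_le ((s, y) : ℝ × ℝ)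
  rw [Real.norm_eq_abs] at this
  unfold weight
  linarith

theorem tendsto_weight_snd (x : ℝ) {l : Filter ℝ} (hl : Tendsto (fun s : ℝ => |s|) l atTop) :
    Tendsto (fun s => weight x s) l atTop := by
  refine tendsto_atTop_mono (fun s => ?_) hl
  have := norm_snd_le ((x, s) : ℝ × ℝ)
  rw [Real.norm_eq_abs] at this
  unfold weight
  linarith

theorem IsOfOrder.tendsto_zero {f : ℝ → ℝ → ℂ} (hf : IsOfOrder (-1) f) {l : Filter ℝ}
    {u v : ℝ → ℝ} (h : Tendsto (fun s => weight (u s) (v s)) l atTop) :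
    Tendsto (fun s => f (u s) (v s)) l (𝓝 0) := by
  obtain ⟨-, C, hC⟩ := hf
  have h1 := (tendsto_inv_atTop_zero.comp h).const_mul C
  rw [mul_zero] at h1
  refine squeeze_zero_norm (fun s => ?_) h1
  simpa using hC (u s) (v s)

/-- Order `-3` in dimension two permits Fubini; order `-1` of the primitive kills the boundary
values on almost every line. -/
theorem integral_fst_deriv_eq_zero {f g : ℝ → ℝ → ℂ} (hf : IsOfOrder (-1) f)
    (hg : IsOfOrder (-3) g) (h : ∀ x y, HasDerivAt (fun s => f s y) (g x y) x) :
    ∫ q : ℝ × ℝ, g q.1 q.2 = 0 := by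
  have hi := hg.integrable
  rw [Measure.volume_eq_prod] at hi ⊢
  rw [integral_prod_symm _ hi]
  refine integral_eq_zero_of_ae ?_
  filter_upwards [hi.prod_left_ae] with y hy
  rw [integral_of_hasDerivAt_of_tendsto (fun x => h x y) hy
    (hf.tendsto_zero (tendsto_weight_fst y tendsto_abs_atBot_atTop))
    (hf.tendsto_zero (tendsto_weight_fst y tendsto_abs_atTop_atTop)), sub_zero]
  rfl

theorem integral_snd_deriv_eq_zero {f g : ℝ → ℝ → ℂ} (hf : IsOfOrder (-1) f)
    (hg : IsOfOrder (-3) g) (h : ∀ x y, HasDerivAt (fun s => f x s) (g x y) y) :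
    ∫ q : ℝ × ℝ, g q.1 q.2 = 0 := by
  have hi := hg.integrable
  rw [Measure.volume_eq_prod] at hi ⊢
  rw [integral_prod _ hi]
  refine integral_eq_zero_of_ae ?_
  filter_upwards [hi.prod_right_ae] with x hx
  rw [integral_of_hasDerivAt_of_tendsto (fun y => h x y) hx
    (hf.tendsto_zero (tendsto_weight_snd x tendsto_abs_atBot_atTop))
    (hf.tendsto_zero (tendsto_weight_snd x tendsto_abs_atTop_atTop)), sub_zero]
  rfl

theorem integral_Ioi_mul_inv_one_add_sq_sq :
    ∫ r in Set.Ioi (0 : ℝ), r * ((1 + r ^ 2) ^ 2)⁻¹ = 1 / 2 := by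
  have hderiv : ∀ r : ℝ, HasDerivAt (fun r : ℝ => -(1 / 2) * (1 + r ^ 2)⁻¹)
      (r * ((1 + r ^ 2) ^ 2)⁻¹) r := by
    intro r
    have h0 : (1 : ℝ) + r ^ 2 ≠ 0 := by positivity
    refine ((((hasDerivAt_pow 2 r).const_add 1).fun_inv h0).const_mul (-(1 / 2))).congr_deriv ?_
    field_simp
    norm_num
  have hlim : Tendsto (fun r : ℝ => -(1 / 2) * (1 + r ^ 2)⁻¹) atTop (𝓝 0) := by
    have h1 : Tendsto (fun r : ℝ => 1 + r ^ 2) atTop atTop :=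
      tendsto_atTop_add_const_left _ _ (tendsto_pow_atTop two_ne_zero)
    simpa only [mul_zero] using! (tendsto_inv_atTop_zero.comp h1).const_mul (-(1 / 2) : ℝ)
  rw [integral_Ioi_of_hasDerivAt_of_nonneg' (fun r _ => hderiv r)
    (fun r hr => by have := Set.mem_Ioi.mp hr; positivity) hlim]
  norm_num

theorem integral_complex_inv_one_add_normSq_sq :
    ∫ z : ℂ, ((1 + ‖z‖ ^ 2) ^ 2)⁻¹ = Real.pi := by
  have h := integral_fun_norm_addHaar (volume : Measure ℂ) (fun r : ℝ => ((1 + r ^ 2) ^ 2)⁻¹)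
  rw [Complex.finrank_real_complex] at h
  simp only [smul_eq_mul, Nat.add_one_sub_one,
    pow_one] at h
  rw [h, integral_Ioi_mul_inv_one_add_sq_sq, Measure.real, Complex.volume_ball]
  simp
  ring

theorem integrable_complex_inv_one_add_normSq_sq :
    Integrable (fun z : ℂ => ((1 + ‖z‖ ^ 2) ^ 2)⁻¹) := by
  have h := integrable_rpow_neg_one_add_norm_sq (E := ℂ) (μ := volume) (r := 4)
    (by rw [Complex.finrank_real_complex]; norm_num)
  refine h.congr (ae_of_all _ fun z => ?_)
  beta_reduce
  rw [show (-4 / 2 : ℝ) = -((2 : ℕ) : ℝ) by norm_num, Real.rpow_neg (by positivity),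
    Real.rpow_natCast]

theorem integral_plane_inv_one_add_sq_sq :
    ∫ u : ℝ, ∫ v : ℝ, ((1 + (u ^ 2 + v ^ 2)) ^ 2)⁻¹ = Real.pi := by
  have e : ∀ q : ℝ × ℝ, ((1 + ‖Complex.measurableEquivRealProd.symm q‖ ^ 2) ^ 2)⁻¹ =
      ((1 + (q.1 ^ 2 + q.2 ^ 2)) ^ 2)⁻¹ := by
    intro q
    rw [Complex.sq_norm, Complex.normSq_apply]
    simp [pow_two]
  have hmp := Complex.volume_preserving_equiv_real_prod.symm
  have h1 := hmp.integral_comp (MeasurableEquiv.measurableEmbedding _)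
    (fun z : ℂ => ((1 + ‖z‖ ^ 2) ^ 2)⁻¹)
  have h2 := (hmp.integrable_comp_emb (MeasurableEquiv.measurableEmbedding _)).mpr
    integrable_complex_inv_one_add_normSq_sq
  simp only [Function.comp_def, e] at h1 h2
  rw [integral_complex_inv_one_add_normSq_sq] at h1
  rw [← h1, Measure.volume_eq_prod, integral_prod _ h2]

theorem norm_linPhase_sq {γ : ℂ → ℂ} {k₀ : ℂ} (hγ : AnalyticAt ℂ γ k₀) (t x y : ℝ) :
    ‖linPhase γ k₀ t x y‖ ^ 2 = (-(2 * k₀.im) * y + (linPhase γ k₀ t 0 0).re) ^ 2 +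
      (x + ((linPhase γ k₀ t 0 0).im + 2 * k₀.re * y)) ^ 2 := by
  rw [linPhase_eq hγ t x y, Complex.sq_norm, Complex.normSq_apply]
  simp
  ring

theorem isSymbol_bracket_inv_sq {γ : ℂ → ℂ} {k₀ : ℂ} (hγ : AnalyticAt ℂ γ k₀) (hk₀ : 0 < k₀.im)
    (t : ℝ) (k : ℕ) :
    IsSymbol k (-4) (fun x y => (bracket γ k₀ t x y)⁻¹ * (bracket γ k₀ t x y)⁻¹) :=
  (isSymbol_bracket_inv hγ hk₀ t k).mul (isSymbol_bracket_inv hγ hk₀ t k)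

/-- A shear in `x` followed by scaling `y` by `-2b` turns the phase into a Cartesian coordinate on
`ℂ`. The rotationally symmetric integral is `π`, and the scaling contributes `1/2b`. -/
theorem integral_bracket_inv_sq {γ : ℂ → ℂ} {k₀ : ℂ} (hγ : AnalyticAt ℂ γ k₀) (hk₀ : 0 < k₀.im)
    (t : ℝ) : ∫ q : ℝ × ℝ, (bracket γ k₀ t q.1 q.2)⁻¹ * (bracket γ k₀ t q.1 q.2)⁻¹ =
      Real.pi / (2 * k₀.im) := by
  set d := linPhase γ k₀ t 0 0 with hd
  have hi := ((isSymbol_bracket_inv_sq hγ hk₀ t 0).mono (by norm_num : (-4 : ℤ) ≤ -3)).integrable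
  have e : ∀ x y, (bracket γ k₀ t x y)⁻¹ * (bracket γ k₀ t x y)⁻¹ =
      ((((1 + ((-(2 * k₀.im) * y + d.re) ^ 2 + (x + (d.im + 2 * k₀.re * y)) ^ 2)) ^ 2)⁻¹ : ℝ) : ℂ) := by
    intro x y
    rw [bracket_eq, norm_linPhase_sq hγ, ← hd, ← mul_inv, ← pow_two]
    push_cast
    rfl
  simp only [e] at hi ⊢
  rw [integral_complex_ofReal]
  have hir := hi.re
  simp only [RCLike.re_eq_complex_re, Complex.ofReal_re] at hir
  rw [Measure.volume_eq_prod] at hir ⊢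
  rw [integral_prod_symm _ hir]
  dsimp only
  have h1 : ∀ y : ℝ, ∫ x : ℝ, ((1 + ((-(2 * k₀.im) * y + d.re) ^ 2 +
      (x + (d.im + 2 * k₀.re * y)) ^ 2)) ^ 2)⁻¹ =
      ∫ v : ℝ, ((1 + ((-(2 * k₀.im) * y + d.re) ^ 2 + v ^ 2)) ^ 2)⁻¹ := fun y =>
    integral_add_right_eq_self
      (fun v : ℝ => ((1 + ((-(2 * k₀.im) * y + d.re) ^ 2 + v ^ 2)) ^ 2)⁻¹) _
  simp only [h1]
  have h2 := Measure.integral_comp_mul_left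
    (fun u : ℝ => ∫ v : ℝ, ((1 + ((u + d.re) ^ 2 + v ^ 2)) ^ 2)⁻¹) (-(2 * k₀.im))
  beta_reduce at h2
  rw [h2, integral_add_right_eq_self (fun u : ℝ => ∫ v : ℝ, ((1 + (u ^ 2 + v ^ 2)) ^ 2)⁻¹) d.re,
    integral_plane_inv_one_add_sq_sq, abs_inv, abs_neg, abs_of_pos (by positivity), smul_eq_mul]
  push_cast
  field_simp

/-! ### Linear equations for `p_n / F_n` and for the coefficients of `μ` -/

/-- The Schur polynomial `p_{n-j}`, vanishing for `j > n`. -/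
def schurShift (γ : ℂ → ℂ) (n : ℕ) (k₀ : ℂ) (t : ℝ) (j : ℕ) (x y : ℝ) : ℂ :=
  schurCoeff γ n k₀ t (PowerSeries.X ^ j) x y

theorem schurShift_zero (γ : ℂ → ℂ) (n : ℕ) (k₀ : ℂ) (t x y : ℝ) :
    schurShift γ n k₀ t 0 x y = schurP γ n k₀ x y t := by
  rw [schurShift, pow_zero, schurCoeff_one]

theorem schurShift_one (γ : ℂ → ℂ) (n : ℕ) (k₀ : ℂ) (t x y : ℝ) :
    schurShift γ n k₀ t 1 x y = schurCoeff γ n k₀ t PowerSeries.X x y := by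
  rw [schurShift, pow_one]

theorem schurCoeff_deriv_fst (γ : ℂ → ℂ) (n : ℕ) (k₀ : ℂ) (t : ℝ) (j : ℕ) (U : PowerSeries ℂ)
    (x y : ℝ) :
    schurCoeff γ n k₀ t (PowerSeries.C I * PowerSeries.X * (PowerSeries.X ^ j * U)) x y =
      I * schurCoeff γ n k₀ t (PowerSeries.X ^ (j + 1) * U) x y := by
  rw [← schurCoeff_C_mul]
  congr 1
  ring

theorem schurCoeff_deriv_snd (γ : ℂ → ℂ) (n : ℕ) (k₀ : ℂ) (t : ℝ) (j : ℕ) (U : PowerSeries ℂ)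
    (x y : ℝ) : schurCoeff γ n k₀ t (PowerSeries.C I * (PowerSeries.C (2 * k₀) * PowerSeries.X +
        PowerSeries.X ^ 2) * (PowerSeries.X ^ j * U)) x y =
      I * (2 * k₀ * schurCoeff γ n k₀ t (PowerSeries.X ^ (j + 1) * U) x y +
        schurCoeff γ n k₀ t (PowerSeries.X ^ (j + 2) * U) x y) := by
  rw [← schurCoeff_C_mul, ← schurCoeff_add, ← schurCoeff_C_mul]
  congr 1
  ring

theorem hasDerivAt_schurShift_fst {γ : ℂ → ℂ} {k₀ : ℂ} (hγ : AnalyticAt ℂ γ k₀) (n : ℕ) (t : ℝ)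
    (j : ℕ) (x y : ℝ) : HasDerivAt (fun s => schurShift γ n k₀ t j s y)
      (I * schurShift γ n k₀ t (j + 1) x y) x := by
  have h := hasDerivAt_schurCoeff_fst hγ n t (PowerSeries.X ^ j * 1) x y
  rw [schurCoeff_deriv_fst] at h
  simpa only [schurShift, mul_one] using h

theorem hasDerivAt_schurShift_snd {γ : ℂ → ℂ} {k₀ : ℂ} (hγ : AnalyticAt ℂ γ k₀) (n : ℕ) (t : ℝ)
    (j : ℕ) (x y : ℝ) : HasDerivAt (fun s => schurShift γ n k₀ t j x s)
      (I * (2 * k₀ * schurShift γ n k₀ t (j + 1) x y + schurShift γ n k₀ t (j + 2) x y)) y := by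
  have h := hasDerivAt_schurCoeff_snd hγ n t (PowerSeries.X ^ j * 1) x y
  rw [schurCoeff_deriv_snd] at h
  simpa only [schurShift, mul_one] using h

theorem hasDerivAt_conjResolvent_fst {γ : ℂ → ℂ} {k₀ : ℂ} (hγ : AnalyticAt ℂ γ k₀) (n : ℕ) (t : ℝ)
    (j : ℕ) (x y : ℝ) : HasDerivAt (fun s => conjResolvent γ n k₀ t j s y)
      (-I * conjResolvent γ n k₀ t (j + 1) x y) x := by
  refine (hasDerivAt_schurCoeff_fst hγ n t (PowerSeries.X ^ j * resolventSeries k₀) x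
    y).star.congr_deriv ?_
  have hI : star I = -I := Complex.conj_I
  rw [schurCoeff_deriv_fst, star_mul', hI, conjResolvent]

theorem hasDerivAt_conjResolvent_snd {γ : ℂ → ℂ} {k₀ : ℂ} (hγ : AnalyticAt ℂ γ k₀) (n : ℕ) (t : ℝ)
    (j : ℕ) (x y : ℝ) : HasDerivAt (fun s => conjResolvent γ n k₀ t j x s)
      (-I * (2 * star k₀ * conjResolvent γ n k₀ t (j + 1) x y +
        conjResolvent γ n k₀ t (j + 2) x y)) y := by
  refine (hasDerivAt_schurCoeff_snd hγ n t (PowerSeries.X ^ j * resolventSeries k₀) x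
    y).star.congr_deriv ?_
  have hI : star I = -I := Complex.conj_I
  have h2 : star (2 : ℂ) = 2 := map_ofNat (starRingEnd ℂ) 2
  rw [schurCoeff_deriv_snd, star_mul', star_add, star_mul', star_mul', hI, h2, conjResolvent,
    conjResolvent]

theorem ofReal_norm_sq (z : ℂ) : ((‖z‖ ^ 2 : ℝ) : ℂ) = z * star z := by
  change _ = z * (starRingEnd ℂ) z
  rw [Complex.mul_conj, Complex.normSq_eq_norm_sq]

theorem ofReal_re_mul_star (z w : ℂ) :
    (((z * star w).re : ℝ) : ℂ) = (z * star w + w * star z) / 2 := by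
  have h := Complex.add_conj (z * star w)
  rw [map_mul] at h
  simp only [Complex.star_def, Complex.conj_conj] at h ⊢
  rw [← mul_comm w] at h
  rw [h]
  push_cast
  ring

/-- The `x`-derivative of `F_n`. -/
def lumpFx (γ : ℂ → ℂ) (n : ℕ) (k₀ : ℂ) (t x y : ℝ) : ℂ :=
  2 * k₀.im * (lumpF γ n k₀ x y t - schurShift γ n k₀ t 0 x y * star (schurShift γ n k₀ t 0 x y))

theorem hasDerivAt_ofReal_lumpF_fst {γ : ℂ → ℂ} {k₀ : ℂ} (hγ : AnalyticAt ℂ γ k₀)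
    (hk₀ : 0 < k₀.im) (n : ℕ) (t x y : ℝ) :
    HasDerivAt (fun s => (lumpF γ n k₀ s y t : ℂ)) (lumpFx γ n k₀ t x y) x := by
  refine (hasDerivAt_lumpF_fst hγ hk₀ n t x y).ofReal_comp.congr_deriv ?_
  rw [ofReal_mul, ofReal_sub, ofReal_norm_sq, lumpFx, schurShift_zero]
  push_cast
  rfl

theorem hasDerivAt_ofReal_lumpF_snd {γ : ℂ → ℂ} {k₀ : ℂ} (hγ : AnalyticAt ℂ γ k₀)
    (hk₀ : 0 < k₀.im) (n : ℕ) (t x y : ℝ) :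
    HasDerivAt (fun s => (lumpF γ n k₀ x s t : ℂ))
      (2 * k₀.re * lumpFx γ n k₀ t x y - 2 * k₀.im *
        (schurShift γ n k₀ t 1 x y * star (schurShift γ n k₀ t 0 x y) +
          schurShift γ n k₀ t 0 x y * star (schurShift γ n k₀ t 1 x y))) y := by
  refine (hasDerivAt_lumpF_snd hγ hk₀ n t x y).ofReal_comp.congr_deriv ?_
  rw [ofReal_sub, ofReal_mul (2 * k₀.re), ofReal_mul (2 * k₀.im), ofReal_sub, ofReal_norm_sq,
    ofReal_mul (4 * k₀.im), ofReal_re_mul_star, lumpFx, schurShift_zero, schurShift_one]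
  push_cast
  ring

theorem hasDerivAt_lumpFx_fst {γ : ℂ → ℂ} {k₀ : ℂ} (hγ : AnalyticAt ℂ γ k₀)
    (hk₀ : 0 < k₀.im) (n : ℕ) (t x y : ℝ) :
    HasDerivAt (fun s => lumpFx γ n k₀ t s y)
      (2 * k₀.im * (lumpFx γ n k₀ t x y -
        (I * schurShift γ n k₀ t 1 x y * star (schurShift γ n k₀ t 0 x y) -
          I * schurShift γ n k₀ t 0 x y * star (schurShift γ n k₀ t 1 x y)))) x := by
  have hp := hasDerivAt_schurShift_fst hγ n t 0 x y
  have hI : star I = -I := Complex.conj_I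
  refine (((hasDerivAt_ofReal_lumpF_fst hγ hk₀ n t x y).sub
    (hp.mul hp.star)).const_mul _).congr_deriv ?_
  rw [star_mul', hI]
  ring

/-- The function `p_n / F_n`. -/
def lumpChi (γ : ℂ → ℂ) (n : ℕ) (k₀ : ℂ) (t x y : ℝ) : ℂ :=
  schurShift γ n k₀ t 0 x y / lumpF γ n k₀ x y t

/-- The `x`-derivative of `p_n / F_n`. -/
def lumpChiX (γ : ℂ → ℂ) (n : ℕ) (k₀ : ℂ) (t x y : ℝ) : ℂ :=
  (I * schurShift γ n k₀ t 1 x y * lumpF γ n k₀ x y t -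
    schurShift γ n k₀ t 0 x y * lumpFx γ n k₀ t x y) / (lumpF γ n k₀ x y t : ℂ) ^ 2

theorem ofReal_lumpF_ne_zero {γ : ℂ → ℂ} {k₀ : ℂ} (hγ : AnalyticAt ℂ γ k₀) (hk₀ : 0 < k₀.im)
    (n : ℕ) (t x y : ℝ) : (lumpF γ n k₀ x y t : ℂ) ≠ 0 := by
  exact_mod_cast (lumpF_pos hγ hk₀ n t x y).ne'

theorem hasDerivAt_lumpChi_fst {γ : ℂ → ℂ} {k₀ : ℂ} (hγ : AnalyticAt ℂ γ k₀)
    (hk₀ : 0 < k₀.im) (n : ℕ) (t x y : ℝ) :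
    HasDerivAt (fun s => lumpChi γ n k₀ t s y) (lumpChiX γ n k₀ t x y) x :=
  (hasDerivAt_schurShift_fst hγ n t 0 x y).fun_div (hasDerivAt_ofReal_lumpF_fst hγ hk₀ n t x y)
    (ofReal_lumpF_ne_zero hγ hk₀ n t x y)

/-- The linear equation for `χ = p_n / F_n` in the potential `u_n`. -/
theorem exists_lumpChi_deriv {γ : ℂ → ℂ} {k₀ : ℂ} (hγ : AnalyticAt ℂ γ k₀)
    (hk₀ : 0 < k₀.im) (n : ℕ) (t x y : ℝ) : ∃ χxx χy : ℂ,
      HasDerivAt (fun s => lumpChiX γ n k₀ t s y) χxx x ∧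
      HasDerivAt (fun s => lumpChi γ n k₀ t x s) χy y ∧
      lumpU γ n k₀ x y t * lumpChi γ n k₀ t x y =
        I * χy - χxx - 2 * I * star k₀ * lumpChiX γ n k₀ t x y := by
  have hF := ofReal_lumpF_ne_zero hγ hk₀ n t x y
  have hF2 : (lumpF γ n k₀ x y t : ℂ) ^ 2 ≠ 0 := pow_ne_zero 2 hF
  have hFx := hasDerivAt_ofReal_lumpF_fst hγ hk₀ n t x y
  refine ⟨_, _, (((((hasDerivAt_schurShift_fst hγ n t 1 x y).const_mul I).mul hFx).sub
    ((hasDerivAt_schurShift_fst hγ n t 0 x y).mul (hasDerivAt_lumpFx_fst hγ hk₀ n t x y))).fun_div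
      (hFx.pow 2) hF2),
    (hasDerivAt_schurShift_snd hγ n t 0 x y).fun_div (hasDerivAt_ofReal_lumpF_snd hγ hk₀ n t x y) hF,
    ?_⟩
  rw [lumpU_eq hγ hk₀, ← schurShift_zero, ← schurShift_one, lumpChi, lumpChiX]
  simp only [lumpFx, Nat.cast_ofNat, zero_add, Pi.mul_apply, Pi.sub_apply, Nat.add_one_sub_one,
    pow_one]
  -- Once everything is expressed through `k₀` and `b`, with the conjugates of `p_n` and `p_{n-1}`
  -- treated as independent variables, the equation is a rational identity.
  have hst : star k₀ = k₀ - 2 * I * k₀.im := by rw [← sub_star_eq]; ring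
  have hre : (k₀.re : ℂ) = k₀ - I * k₀.im := by
    rw [mul_comm, eq_sub_iff_add_eq, Complex.re_add_im]
  rw [hst, hre]
  generalize star (schurShift γ n k₀ t 0 x y) = q
  generalize star (schurShift γ n k₀ t 1 x y) = q1
  field_simp
  ring_nf
  simp only [I_sq, I_pow_three]
  ring

/-! ### Exact derivatives and the higher coefficients at `conj k₀` -/

/-- `f` is integrable over the plane with integral `c`. -/
def HasPlaneIntegral (f : ℝ → ℝ → ℂ) (c : ℂ) : Prop :=
  Integrable (fun q : ℝ × ℝ => f q.1 q.2) ∧ ∫ q : ℝ × ℝ, f q.1 q.2 = c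

theorem HasPlaneIntegral.add {f g : ℝ → ℝ → ℂ} {a b : ℂ} (hf : HasPlaneIntegral f a)
    (hg : HasPlaneIntegral g b) : HasPlaneIntegral (fun x y => f x y + g x y) (a + b) :=
  ⟨hf.1.add hg.1, by rw [integral_add hf.1 hg.1, hf.2, hg.2]⟩

theorem HasPlaneIntegral.sub {f g : ℝ → ℝ → ℂ} {a b : ℂ} (hf : HasPlaneIntegral f a)
    (hg : HasPlaneIntegral g b) : HasPlaneIntegral (fun x y => f x y - g x y) (a - b) :=
  ⟨hf.1.sub hg.1, by rw [integral_sub hf.1 hg.1, hf.2, hg.2]⟩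

theorem HasPlaneIntegral.const_mul {f : ℝ → ℝ → ℂ} {a : ℂ} (c : ℂ) (hf : HasPlaneIntegral f a) :
    HasPlaneIntegral (fun x y => c * f x y) (c * a) :=
  ⟨hf.1.const_mul c, by rw [integral_const_mul, hf.2]⟩

theorem HasPlaneIntegral.congr {f g : ℝ → ℝ → ℂ} {a b : ℂ} (hf : HasPlaneIntegral f a)
    (h : ∀ x y, g x y = f x y) (hab : a = b) : HasPlaneIntegral g b := by
  rw [show g = f from funext₂ h, ← hab]
  exact hf

theorem hasPlaneIntegral_fst_deriv {k : ℕ} {m : ℤ} {f g : ℝ → ℝ → ℂ} (hf : IsSymbol (k + 1) m f)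
    (hm : m ≤ -2) (h : ∀ x y, HasDerivAt (fun s => f s y) (g x y) x) : HasPlaneIntegral g 0 := by
  have hg := (hf.fst h).isOfOrder.mono (by omega : m - 1 ≤ -3)
  exact ⟨hg.integrable, integral_fst_deriv_eq_zero (hf.isOfOrder.mono (by omega)) hg h⟩

theorem hasPlaneIntegral_snd_deriv {k : ℕ} {m : ℤ} {f g : ℝ → ℝ → ℂ} (hf : IsSymbol (k + 1) m f)
    (hm : m ≤ -2) (h : ∀ x y, HasDerivAt (fun s => f x s) (g x y) y) : HasPlaneIntegral g 0 := by
  have hg := (hf.snd h).isOfOrder.mono (by omega : m - 1 ≤ -3)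
  exact ⟨hg.integrable, integral_snd_deriv_eq_zero (hf.isOfOrder.mono (by omega)) hg h⟩

/-- The coefficient of `(k - conj k₀)^{-j}` in `μ`. -/
def lumpPole (γ : ℂ → ℂ) (n : ℕ) (k₀ : ℂ) (t : ℝ) (j : ℕ) (x y : ℝ) : ℂ :=
  lumpChi γ n k₀ t x y * conjResolvent γ n k₀ t j x y

/-- The `x`-derivative of `lumpPole`. -/
def lumpPoleX (γ : ℂ → ℂ) (n : ℕ) (k₀ : ℂ) (t : ℝ) (j : ℕ) (x y : ℝ) : ℂ :=
  lumpChiX γ n k₀ t x y * conjResolvent γ n k₀ t j x y +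
    lumpChi γ n k₀ t x y * (-I * conjResolvent γ n k₀ t (j + 1) x y)

theorem hasDerivAt_lumpPole_fst {γ : ℂ → ℂ} {k₀ : ℂ} (hγ : AnalyticAt ℂ γ k₀)
    (hk₀ : 0 < k₀.im) (n : ℕ) (t : ℝ) (j : ℕ) (x y : ℝ) :
    HasDerivAt (fun s => lumpPole γ n k₀ t j s y) (lumpPoleX γ n k₀ t j x y) x :=
  (hasDerivAt_lumpChi_fst hγ hk₀ n t x y).mul (hasDerivAt_conjResolvent_fst hγ n t j x y)

/-- The linear equation satisfied by the coefficients of `μ` at `conj k₀`. -/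
theorem exists_lumpPole_deriv {γ : ℂ → ℂ} {k₀ : ℂ} (hγ : AnalyticAt ℂ γ k₀)
    (hk₀ : 0 < k₀.im) (n : ℕ) (t : ℝ) (j : ℕ) (x y : ℝ) : ∃ Nxx Ny : ℂ,
      HasDerivAt (fun s => lumpPoleX γ n k₀ t j s y) Nxx x ∧
      HasDerivAt (fun s => lumpPole γ n k₀ t j x s) Ny y ∧
      lumpU γ n k₀ x y t * lumpPole γ n k₀ t j x y =
        I * Ny - Nxx - 2 * I * star k₀ * lumpPoleX γ n k₀ t j x y -
          2 * I * lumpPoleX γ n k₀ t (j + 1) x y := by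
  obtain ⟨χxx, χy, hxx, hy, h⟩ := exists_lumpChi_deriv hγ hk₀ n t x y
  refine ⟨_, _, (hxx.mul (hasDerivAt_conjResolvent_fst hγ n t j x y)).add
    ((hasDerivAt_lumpChi_fst hγ hk₀ n t x y).mul
      ((hasDerivAt_conjResolvent_fst hγ n t (j + 1) x y).const_mul (-I))),
    hy.mul (hasDerivAt_conjResolvent_snd hγ n t j x y), ?_⟩
  -- By `g_x = -i g_{j+1}` and the matching `y`-equation, all terms with derivatives of `g_j` cancel
  -- against the `x`-derivative of the next coefficient, leaving the equation for `χ` times `g_j`.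
  rw [lumpPole, lumpPoleX, lumpPoleX, ← mul_assoc, h]
  ring_nf

theorem isSymbol_lumpChi {γ : ℂ → ℂ} {k₀ : ℂ} (hγ : AnalyticAt ℂ γ k₀) (hk₀ : 0 < k₀.im)
    (n : ℕ) (t : ℝ) (k : ℕ) : IsSymbol k (-n) (lumpChi γ n k₀ t) := by
  unfold lumpChi
  simp only [div_eq_mul_inv]
  exact ((isSymbol_schurCoeff hγ t k n _).mul (isSymbol_lumpF_inv hγ hk₀ n t k)).mono (by omega)

theorem isSymbol_conjResolvent {γ : ℂ → ℂ} {k₀ : ℂ} (hγ : AnalyticAt ℂ γ k₀)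
    (n : ℕ) (t : ℝ) (k j : ℕ) : IsSymbol k (n - j) (conjResolvent γ n k₀ t j) :=
  (isSymbol_schurCoeff_X_pow_mul hγ t k n j _).star

theorem isSymbol_lumpPole {γ : ℂ → ℂ} {k₀ : ℂ} (hγ : AnalyticAt ℂ γ k₀) (hk₀ : 0 < k₀.im)
    (n : ℕ) (t : ℝ) (k j : ℕ) : IsSymbol k (-j) (lumpPole γ n k₀ t j) :=
  ((isSymbol_lumpChi hγ hk₀ n t k).mul (isSymbol_conjResolvent hγ n t k j)).mono (by omega)

/-- The integrand is a combination of derivatives of symbols of order at most `-2`, each of which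
has integral zero. -/
theorem hasPlaneIntegral_lumpU_mul_lumpPole {γ : ℂ → ℂ} {k₀ : ℂ} (hγ : AnalyticAt ℂ γ k₀)
    (hk₀ : 0 < k₀.im) (n : ℕ) (t : ℝ) {j : ℕ} (hj : 2 ≤ j) :
    HasPlaneIntegral (fun x y => lumpU γ n k₀ x y t * lumpPole γ n k₀ t j x y) 0 := by
  choose Nxx Ny hxx hy h using fun x y => exists_lumpPole_deriv hγ hk₀ n t j x y
  have hN := isSymbol_lumpPole hγ hk₀ n t 2 j
  have hNx := hN.fst (hasDerivAt_lumpPole_fst hγ hk₀ n t j)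
  have h1 := hasPlaneIntegral_snd_deriv hN (by omega) hy
  have h2 := hasPlaneIntegral_fst_deriv hNx (by omega) hxx
  have h3 := hasPlaneIntegral_fst_deriv hN (by omega) (hasDerivAt_lumpPole_fst hγ hk₀ n t j)
  have h4 := hasPlaneIntegral_fst_deriv (isSymbol_lumpPole hγ hk₀ n t 1 (j + 1))
    (by push_cast; omega) (hasDerivAt_lumpPole_fst hγ hk₀ n t (j + 1))
  exact ((((h1.const_mul I).sub h2).sub (h3.const_mul (2 * I * star k₀))).sub
    (h4.const_mul (2 * I))).congr h (by ring)

/-! ### The borderline coefficient `j = 1` and its flux at infinity -/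

/-- The leading part at infinity of the residue of `μ` at `conj k₀`, divided by `n`. -/
def modelPole (γ : ℂ → ℂ) (k₀ : ℂ) (t x y : ℝ) : ℂ :=
  linPhase γ k₀ t x y * (bracket γ k₀ t x y)⁻¹

theorem bracket_ne_zero (γ : ℂ → ℂ) (k₀ : ℂ) (t x y : ℝ) : bracket γ k₀ t x y ≠ 0 := by
  rw [bracket_eq]
  exact_mod_cast (by positivity : (1 + ‖linPhase γ k₀ t x y‖ ^ 2 : ℝ) ≠ 0)

/-- Over the common denominator `F(1 + |ζ|²)` the numerator is `p_n g_1 (1 + |ζ|²) - nζF`. Both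
products have leading part `nζ|ζ|^{2n}/n!²` up to the same factor `|ζ|^0`, so one order cancels. -/
theorem isSymbol_lumpPole_sub_modelPole {γ : ℂ → ℂ} {k₀ : ℂ} (hγ : AnalyticAt ℂ γ k₀)
    (hk₀ : 0 < k₀.im) {n : ℕ} (hn : 1 ≤ n) (t : ℝ) (k : ℕ) :
    IsSymbol k (-2) (fun x y => lumpPole γ n k₀ t 1 x y - n * modelPole γ k₀ t x y) := by
  obtain ⟨m, rfl⟩ := Nat.exists_eq_add_of_le' hn
  set ζ := linPhase γ k₀ t with hζdef
  have hζ : IsSymbol k 1 ζ := isSymbol_linPhase hγ t k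
  have hlead : ∀ j : ℕ, IsSymbol k j (fun x y => ζ x y ^ j / j.factorial) := fun j => by
    simp only [div_eq_inv_mul]
    simpa using (hζ.pow j).const_mul (j.factorial : ℂ)⁻¹
  have hp : IsSymbol k ((m + 1 : ℕ) : ℤ) (fun x y => schurP γ (m + 1) k₀ x y t) :=
    isSymbol_schurP hγ t k (m + 1)
  have hp0 := isSymbol_schurP_sub hγ t k (m + 1)
  have hg : IsSymbol k (m : ℤ) (conjResolvent γ (m + 1) k₀ t 1) :=
    (isSymbol_conjResolvent hγ (m + 1) t k 1).mono (by push_cast; omega)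
  have hg0 : IsSymbol k ((m : ℤ) - 1) (fun x y => conjResolvent γ (m + 1) k₀ t 1 x y -
      star (ζ x y ^ m / m.factorial)) := by
    have h := (isSymbol_schurCoeff_sub hγ t k m (U := resolventSeries k₀)
      (by simp [resolventSeries, shiftSeries])).star
    have e : ∀ x y, conjResolvent γ (m + 1) k₀ t 1 x y =
        star (schurCoeff γ m k₀ t (resolventSeries k₀) x y) := fun x y => by
      rw [conjResolvent, schurCoeff_X_pow_mul_of_le _ _ _ _ _ _ (by omega), Nat.add_sub_cancel]
    simp only [star_sub] at h
    simpa only [e] using h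
  have hpg := hp.mul hg
  have hpg0 := hp.mul_sub_mul (hlead m).star hp0 hg0
  have hB0 : IsSymbol k (2 - 1) (fun x y => bracket γ k₀ t x y - ζ x y * star (ζ x y)) := by
    have e : ∀ x y, bracket γ k₀ t x y - ζ x y * star (ζ x y) = 1 := fun x y => by
      rw [bracket]; ring
    simp only [e]
    exact (isSymbol_const k 1).mono (by norm_num)
  have h1 := hpg.mul_sub_mul (g := bracket γ k₀ t) (m' := 2)
    ((hζ.mul hζ.star).mono (by norm_num)) hpg0 hB0
  have h2 := (hζ.mul (isSymbol_lumpF_sub hγ hk₀ (m + 1) t k)).const_mul ((m : ℂ) + 1)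
  have h3 := (h1.sub (h2.mono (by push_cast; omega))).mul ((isSymbol_lumpF_inv hγ hk₀ (m + 1) t k).mul
    (isSymbol_bracket_inv hγ hk₀ t k))
  refine (show IsSymbol k (-2) _ from ?_)
  convert h3.mono (m' := -2) (by push_cast; omega) using 1
  ext x y
  have hF := ofReal_lumpF_ne_zero hγ hk₀ (m + 1) t x y
  have hB := bracket_ne_zero γ k₀ t x y
  have hm : (m : ℂ) + 1 ≠ 0 := Nat.cast_add_one_ne_zero m
  have hm' : (m.factorial : ℂ) ≠ 0 := by exact_mod_cast m.factorial_ne_zero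
  have hstar : star ((m : ℂ) + 1) = (m : ℂ) + 1 := by simp
  have hstar' : star (m.factorial : ℂ) = m.factorial := by simp
  rw [lumpPole, lumpChi, modelPole, schurShift_zero, Nat.factorial_succ]
  push_cast
  rw [← hζdef]
  generalize ζ x y = z at *
  simp only [star_div₀, star_pow, star_mul', hstar, hstar']
  field_simp
  ring

theorem hasDerivAt_linPhase_fst {γ : ℂ → ℂ} {k₀ : ℂ} (hγ : AnalyticAt ℂ γ k₀) (t x y : ℝ) :
    HasDerivAt (fun s => linPhase γ k₀ t s y) I x := by
  rw [show (fun s => linPhase γ k₀ t s y) = _ from funext fun s => linPhase_eq hγ t s y]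
  have h := (((hasDerivAt_id x).ofReal_comp.const_mul I).const_add
    (linPhase γ k₀ t 0 0)).add_const (2 * I * k₀ * y)
  refine h.congr_deriv ?_
  simp

theorem hasDerivAt_linPhase_snd {γ : ℂ → ℂ} {k₀ : ℂ} (hγ : AnalyticAt ℂ γ k₀) (t x y : ℝ) :
    HasDerivAt (fun s => linPhase γ k₀ t x s) (2 * I * k₀) y := by
  rw [show (fun s => linPhase γ k₀ t x s) = _ from funext fun s => linPhase_eq hγ t x s]
  have h := ((hasDerivAt_id y).ofReal_comp.const_mul (2 * I * k₀)).const_add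
    (linPhase γ k₀ t 0 0 + I * x)
  refine h.congr_deriv ?_
  simp

/-- The operator `i∂_y - 2i k̄₀ ∂_x` annihilates `ζ̄` and sends `ζ` to `-4ib`, so it is `-4ib ∂_ζ`;
and `∂_ζ (ζ/(1 + ζζ̄)) = (1 + ζζ̄)⁻²`. -/
theorem exists_modelPole_deriv {γ : ℂ → ℂ} {k₀ : ℂ} (hγ : AnalyticAt ℂ γ k₀) (t x y : ℝ) :
    ∃ Sx Sy : ℂ, HasDerivAt (fun s => modelPole γ k₀ t s y) Sx x ∧
      HasDerivAt (fun s => modelPole γ k₀ t x s) Sy y ∧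
      I * Sy - 2 * I * star k₀ * Sx =
        -(4 * I * k₀.im) * ((bracket γ k₀ t x y)⁻¹ * (bracket γ k₀ t x y)⁻¹) := by
  have hB := bracket_ne_zero γ k₀ t x y
  have hx := hasDerivAt_linPhase_fst hγ t x y
  have hy := hasDerivAt_linPhase_snd hγ t x y
  refine ⟨_, _, hx.mul (((hx.mul hx.star).const_add 1).fun_inv hB),
    hy.mul (((hy.mul hy.star).const_add 1).fun_inv hB), ?_⟩
  have hI : star I = -I := Complex.conj_I
  have h2 : star (2 : ℂ) = 2 := map_ofNat (starRingEnd ℂ) 2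
  have hst : star k₀ = k₀ - 2 * I * k₀.im := by rw [← sub_star_eq]; ring
  rw [bracket] at hB ⊢
  simp only [hI, star_mul', h2, hst, Pi.mul_apply]
  generalize star (linPhase γ k₀ t x y) = w at hB ⊢
  field_simp
  ring_nf
  simp only [I_sq]
  ring

/-- The first-order terms are applied to the difference from the model, which is of order `-2` and
has no flux. The other two terms have enough decay already. The model itself contributes `-4ib n ·
π/2b`. -/
theorem hasPlaneIntegral_lumpU_mul_lumpPole_one {γ : ℂ → ℂ} {k₀ : ℂ} (hγ : AnalyticAt ℂ γ k₀)
    (hk₀ : 0 < k₀.im) {n : ℕ} (hn : 1 ≤ n) (t : ℝ) :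
    HasPlaneIntegral (fun x y => lumpU γ n k₀ x y t * lumpPole γ n k₀ t 1 x y)
      (-(2 * Real.pi * I * n)) := by
  have hb : (k₀.im : ℂ) ≠ 0 := by exact_mod_cast hk₀.ne'
  choose Nxx Ny hxx hy h using fun x y => exists_lumpPole_deriv hγ hk₀ n t 1 x y
  choose Sx Sy hSx hSy hS using fun x y => exists_modelPole_deriv hγ t x y
  have hNx := hasDerivAt_lumpPole_fst hγ hk₀ n t 1
  have hT := isSymbol_lumpPole_sub_modelPole hγ hk₀ hn t 1
  have h1 := hasPlaneIntegral_snd_deriv hT le_rfl fun x y =>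
    (hy x y).sub ((hSy x y).const_mul (n : ℂ))
  have h2 := hasPlaneIntegral_fst_deriv ((isSymbol_lumpPole hγ hk₀ n t 2 1).fst hNx)
    (by norm_num) hxx
  have h3 := hasPlaneIntegral_fst_deriv hT le_rfl fun x y =>
    (hNx x y).sub ((hSx x y).const_mul (n : ℂ))
  have h4 := hasPlaneIntegral_fst_deriv (isSymbol_lumpPole hγ hk₀ n t 1 2)
    (by norm_num) (hasDerivAt_lumpPole_fst hγ hk₀ n t 2)
  have h5 : HasPlaneIntegral (fun x y => (bracket γ k₀ t x y)⁻¹ * (bracket γ k₀ t x y)⁻¹)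
      (Real.pi / (2 * k₀.im)) :=
    ⟨((isSymbol_bracket_inv_sq hγ hk₀ t 0).mono (by norm_num : (-4 : ℤ) ≤ -3)).integrable,
      integral_bracket_inv_sq hγ hk₀ t⟩
  refine (((((h1.const_mul I).sub h2).sub (h3.const_mul (2 * I * star k₀))).sub
    (h4.const_mul (2 * I))).add (h5.const_mul (-(4 * I * k₀.im) * n))).congr (fun x y => ?_) ?_
  · rw [h]
    linear_combination (n : ℂ) * hS x y
  · field_simp
    ring

/-! ### The residue at `k₀` and the conclusion -/

/-- The logarithmic derivative `∂_x log F_n`. -/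
def logDerivF (γ : ℂ → ℂ) (n : ℕ) (k₀ : ℂ) (t x y : ℝ) : ℂ :=
  lumpFx γ n k₀ t x y * (lumpF γ n k₀ x y t : ℂ)⁻¹

theorem isSymbol_logDerivF {γ : ℂ → ℂ} {k₀ : ℂ} (hγ : AnalyticAt ℂ γ k₀) (hk₀ : 0 < k₀.im)
    (n : ℕ) (t : ℝ) (k : ℕ) : IsSymbol k (-1) (logDerivF γ n k₀ t) :=
  (((isSymbol_lumpF hγ hk₀ n t (k + 1)).fst (hasDerivAt_ofReal_lumpF_fst hγ hk₀ n t)).mul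
    (isSymbol_lumpF_inv hγ hk₀ n t k)).mono (by omega)

theorem hasDerivAt_logDerivF {γ : ℂ → ℂ} {k₀ : ℂ} (hγ : AnalyticAt ℂ γ k₀) (hk₀ : 0 < k₀.im)
    (n : ℕ) (t x y : ℝ) :
    HasDerivAt (fun s => logDerivF γ n k₀ t s y) (lumpU γ n k₀ x y t / 2) x := by
  have hF := ofReal_lumpF_ne_zero hγ hk₀ n t x y
  refine ((hasDerivAt_lumpFx_fst hγ hk₀ n t x y).mul
    ((hasDerivAt_ofReal_lumpF_fst hγ hk₀ n t x y).fun_inv hF)).congr_deriv ?_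
  rw [lumpU_eq hγ hk₀, ← schurShift_zero, ← schurShift_one, lumpFx]
  field_simp
  ring

/-- The residue is `i F_x/F` minus the residue at `k̄₀`. Since `u/2` is the `x`-derivative of `w =
F_x/F`, the product `u w` is `∂_x(w²)` with `w²` of order `-2`, and it integrates to zero. -/
theorem hasPlaneIntegral_lumpU_mul_residueUp {γ : ℂ → ℂ} {k₀ : ℂ} (hγ : AnalyticAt ℂ γ k₀)
    (hk₀ : 0 < k₀.im) {n : ℕ} (hn : 1 ≤ n) (t : ℝ) :
    HasPlaneIntegral (fun x y => lumpU γ n k₀ x y t * residueUp γ n k₀ t x y)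
      (2 * Real.pi * I * n) := by
  have hw := isSymbol_logDerivF hγ hk₀ n t 1
  have h1 := hasPlaneIntegral_fst_deriv (hw.mul hw) (by norm_num) fun x y =>
    (hasDerivAt_logDerivF hγ hk₀ n t x y).mul (hasDerivAt_logDerivF hγ hk₀ n t x y)
  refine ((h1.const_mul I).sub (hasPlaneIntegral_lumpU_mul_lumpPole_one hγ hk₀ hn t)).congr
    (fun x y => ?_) (by ring)
  have hF := ofReal_lumpF_ne_zero hγ hk₀ n t x y
  rw [residueUp, lumpPole, lumpChi, logDerivF, lumpFx, sub_star_eq, ← schurShift_zero]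
  field_simp
  ring

theorem sign_im_star {k₀ : ℂ} (hk₀ : 0 < k₀.im) : Real.sign (star k₀).im = -1 :=
  Real.sign_of_neg (by simpa using hk₀)

theorem lumpU_mul_residue_mu {γ : ℂ → ℂ} {k₀ : ℂ} (hγ : AnalyticAt ℂ γ k₀)
    (hk₀ : 0 < k₀.im) {n : ℕ} (hn : 1 ≤ n) (t : ℝ) :
    HasPlaneIntegral (fun x y => lumpU γ n k₀ x y t * residue (mu γ n k₀ x y t) k₀)
      (2 * Real.pi * I * n) ∧
    HasPlaneIntegral (fun x y => lumpU γ n k₀ x y t * residue (mu γ n k₀ x y t) (star k₀))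
      (-(2 * Real.pi * I * n)) := by
  constructor
  · simpa only [residue_mu_self hγ hk₀] using hasPlaneIntegral_lumpU_mul_residueUp hγ hk₀ hn t
  · have e : ∀ x y, residue (mu γ n k₀ x y t) (star k₀) = lumpPole γ n k₀ t 1 x y := fun x y => by
      rw [residue, lumpPole, lumpChi, schurShift_zero]
      exact_mod_cast laurentCoeff_mu_star hγ hk₀ t x y le_rfl hn
    simpa only [e] using hasPlaneIntegral_lumpU_mul_lumpPole_one hγ hk₀ hn t

end

end KPLump

theorem mainTheorem6 (n : ℕ) (hn : 1 ≤ n) (k₀ : ℂ) (hk₀ : 0 < k₀.im)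
    (γ : ℂ → ℂ) (hγ : AnalyticAt ℂ γ k₀) (t : ℝ) :
    (∀ (x y : ℝ) (k : ℂ), -k₀.im < k.im → k ≠ k₀ →
      KPLump.darbouxPsi γ n k₀ x y t k =
        KPLump.mu γ n k₀ x y t k * Complex.exp (Complex.I * KPLump.theta γ k x y t)) ∧
    (∀ kα : ℂ, kα = k₀ ∨ kα = star k₀ →
      MeasureTheory.Integrable (fun q : ℝ × ℝ =>
        (KPLump.lumpU γ n k₀ q.1 q.2 t : ℂ) *
          KPLump.residue (KPLump.mu γ n k₀ q.1 q.2 t) kα) ∧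
      KPLump.charge γ n k₀ kα t = n) ∧
    (∀ j : ℕ, 2 ≤ j → j ≤ n →
      MeasureTheory.Integrable (fun q : ℝ × ℝ =>
        (KPLump.lumpU γ n k₀ q.1 q.2 t : ℂ) * KPLump.muBar γ n k₀ j q.1 q.2 t) ∧
      (∫ q : ℝ × ℝ,
        (KPLump.lumpU γ n k₀ q.1 q.2 t : ℂ) * KPLump.muBar γ n k₀ j q.1 q.2 t) = 0) := by
  have hpi : (Real.pi : ℂ) ≠ 0 := by exact_mod_cast Real.pi_ne_zero
  have hI := Complex.I_ne_zero
  obtain ⟨h1, h2⟩ := KPLump.lumpU_mul_residue_mu hγ hk₀ hn t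
  refine ⟨fun x y k hk hkk => KPLump.darbouxPsi_eq hγ hk₀ n t x y hk hkk, ?_, fun j hj hjn => ?_⟩
  · rintro kα (rfl | rfl)
    -- The integrals at the two poles are opposite, and so are the signs of the imaginary parts;
    -- both charges therefore equal `n`.
    · refine ⟨h1.1, ?_⟩
      rw [KPLump.charge, h1.2, Real.sign_of_pos hk₀]
      push_cast
      field_simp
    · refine ⟨h2.1, ?_⟩
      rw [KPLump.charge, h2.2, KPLump.sign_im_star hk₀]
      push_cast
      field_simp
  · have e : ∀ x y, KPLump.muBar γ n k₀ j x y t = KPLump.lumpPole γ n k₀ t j x y := fun x y => by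
      rw [KPLump.muBar, KPLump.lumpPole, KPLump.lumpChi, KPLump.schurShift_zero]
      exact KPLump.laurentCoeff_mu_star hγ hk₀ t x y (by omega) hjn
    simp only [e]
    exact KPLump.hasPlaneIntegral_lumpU_mul_lumpPole hγ hk₀ n t hj
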